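/- Let $d\ge 1$, $a<b$ and $0<H<1$, and let $\omega=(\omega_t)_{t\in[a,b]}$ be an $\mathbb{R}^d$-valued Gaussian process with (almost surely) continuous paths, on some probability space. Write $\omega_{st}=\omega_t-\omega_s$ and suppose that there is a constant $c>0$ such that for all $s,t\in[a,b]$ $$\mathrm{Cov}(\omega_{st})\ \ge\ c\,|t-s|^{2H}\,\mathrm{Id}$$ in the sense of symmetric matrices (the difference is positive semidefinite). Let $\mu^\omega_{a,t}=\int_a^t\delta_{\omega_r}\,dr$ be the occupation measure of $\omega$. Then for every $\alpha$ with $0<\alpha<\frac1{2H}-\frac d2$ that is not an even integer, almost surely $$\mu^\omega_{a,\cdot}\in V^2(a,b;\mathrm{SBE}^{\alpha,2}_2).$$ Here, for a compactly supported finite (signed) measure $\mu$ on $\mathbb{R}^d$, put $F_\mu(r,y)=\mu(\{x:|x-y|\le r\})$ and, for functions $F$ of $r$, $\Delta_0F(r)=F(r)-F(r/2)$ and $\Delta_{k+1}F(r)=\Delta_kF(r)-2^{k+1}\Delta_kF(r/2)$. For $\alpha>0$ and $1\le p,q\le\infty$, $\mu\in\mathrm{SBE}^{\alpha,p}_q$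 means that, with $k=\lceil\alpha+d-1\rceil$, the norm $$\|\mu\|_{\mathrm{SBE}^{\alpha,p}_q}=\big\|\,r^{-\alpha-d}(\Delta_k)_rF_\mu(r,y)\,\big\|_{L^q_y(\mathbb{R}^d,\,dy;\ L^p_r((0,\infty),\,dr/r))}$$ is finite. Finally, $f\in V^2(a,b;\mathrm{SBE}^{\alpha,2}_2)$ means that $f(t)\in\mathrm{SBE}^{\alpha,2}_2$ for every $t\in[a,b]$ and that $$\sup_{a=t_0<t_1<\dots<t_n=b}\ \sum_{h=1}^n\|f(t_h)-f(t_{h-1})\|^2_{\mathrm{SBE}^{\alpha,2}_2}<\infty,$$ the supremum being over all finite partitions of $[a,b]$. -/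

import Mathlib

open MeasureTheory ProbabilityTheory Set
open scoped ENNReal NNReal

noncomputable section

namespace SmallBall

/-- Euclidean space `ℝ^d`. -/
abbrev Rd (d : ℕ) : Type := EuclideanSpace ℝ (Fin d)

/-- `F_μ(r, y) = μ {x : |x - y| ≤ r}`. It is defined for signed measures, so that it applies to
the differences of finite measures which occur in the variation. -/
def ballFun {d : ℕ} (μ : SignedMeasure (Rd d)) (r : ℝ) (y : Rd d) : ℝ :=
  μ (Metric.closedBall y r)

/-- The operators `Δ_k`: `Δ_0 F (r) = F r - F (r/2)` and
`Δ_{k+1} F (r) = Δ_k F (r) - 2^{k+1} Δ_k F (r/2)`. -/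
def deltaOp : ℕ → (ℝ → ℝ) → ℝ → ℝ
  | 0, F => fun r => F r - F (r / 2)
  | k + 1, F => fun r => deltaOp k F r - 2 ^ (k + 1) * deltaOp k F (r / 2)

/-- The measure `dr / r` on `(0, ∞)`. -/
def scaleMeasure : Measure ℝ :=
  (volume.restrict (Ioi (0 : ℝ))).withDensity fun r => ENNReal.ofReal r⁻¹

/-- The `SBE_q^{α,p}` norm, with values in `[0, ∞]`: with `k = ⌈α + d - 1⌉`, the `L^q` norm in `y`
(with respect to `dy`) of the `L^p` norm in `r` (with respect to `dr / r` on `(0, ∞)`) of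
`r^{-α-d} (Δ_k)_r F_μ(r, y)`. -/
def sbeNorm {d : ℕ} (α : ℝ) (p q : ℝ≥0∞) (μ : SignedMeasure (Rd d)) : ℝ≥0∞ :=
  eLpNorm
    (fun y : Rd d =>
      eLpNorm
        (fun r : ℝ => r ^ (-α - (d : ℝ)) * deltaOp ⌈α + (d : ℝ) - 1⌉₊ (fun r' => ballFun μ r' y) r)
        p scaleMeasure)
    q volume

/-- A signed measure vanishing outside some compact set. -/
def IsCompactlySupported {d : ℕ} (μ : SignedMeasure (Rd d)) : Prop :=
  ∃ K : Set (Rd d), IsCompact K ∧ ∀ A : Set (Rd d), MeasurableSet A → Disjoint A K → μ A = 0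

/-- Membership in `SBE_q^{α,p}`: compact support and finite norm. -/
def MemSBE {d : ℕ} (α : ℝ) (p q : ℝ≥0∞) (μ : SignedMeasure (Rd d)) : Prop :=
  IsCompactlySupported μ ∧ sbeNorm α p q μ < ∞

/-- The `ρ`-variation over `[a, b]`, measured with the `[0, ∞]`-valued norm `N`, of a function `f`:
the supremum of `∑ N (f t_{h+1} - f t_h) ^ ρ` over all partitions `a = t_0 < t_1 < ⋯ < t_n = b`. -/
def eVar {G : Type*} [AddGroup G] (N : G → ℝ≥0∞) (ρ a b : ℝ) (f : ℝ → G) : ℝ≥0∞ :=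
  ⨆ (n : ℕ) (t : Fin (n + 1) → ℝ) (_ : StrictMono t ∧ t 0 = a ∧ t (Fin.last n) = b),
    ∑ h : Fin n, N (f (t h.succ) - f (t h.castSucc)) ^ ρ

/-- `f ∈ V^ρ(a, b; SBE_q^{α,p})`: `f` takes values in `SBE_q^{α,p}` on `[a, b]`, and has finite
`ρ`-variation there with respect to the norm of that space. -/
def MemVSBE {d : ℕ} (α : ℝ) (p q : ℝ≥0∞) (ρ a b : ℝ) (f : ℝ → SignedMeasure (Rd d)) : Prop :=
  (∀ t ∈ Icc a b, MemSBE α p q (f t)) ∧ eVar (sbeNorm α p q) ρ a b f < ∞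

/-- The occupation measure `μ_{s,t} = ∫_s^t δ_{w_r} dr` of a path `w`, that is, the push-forward
under `w` of Lebesgue measure on `[s, t]`. -/
def occupationMeasure {d : ℕ} (w : ℝ → Rd d) (s t : ℝ) : Measure (Rd d) :=
  (volume.restrict (Icc s t)).map w

instance {d : ℕ} (w : ℝ → Rd d) (s t : ℝ) : IsFiniteMeasure (occupationMeasure w s t) := by
  unfold occupationMeasure; infer_instance

/-- The covariance matrix of a random vector in `ℝ^d`. -/
def covMatrix {Ω : Type*} [MeasurableSpace Ω] {d : ℕ} (Y : Ω → Rd d) (P : Measure Ω) :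
    Matrix (Fin d) (Fin d) ℝ :=
  Matrix.of fun i j => covariance (fun ω => Y ω i) (fun ω => Y ω j) P

end SmallBall

end

/-! On the Fourier side both the norm and the randomness become explicit. The Fourier transform of
`y ↦ μ (closedBall y r)` is the transform of `μ` times that of the indicator of a ball, so by
Plancherel the squared norm is an integral of `|μ̂(ξ)|²` against a multiplier. Since `Δ_k` kills `r
^ m` for `m ≤ k` and the odd moments of a ball vanish, this multiplier comes from a symbol of size
`r ^ d * min 1 ((r * ‖ξ‖) ^ (2 * J))` with `2 * J > α`. Integrating over scales bounds the squared
norm by a multiple of the energy `∫ ‖ξ‖ ^ (2α) |μ̂(ξ)|² dξ` (`exists_sbeNorm_sq_le`).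

For the occupation measure of `[s, t]`, the expectation of `|μ̂(ξ)|²` is at most the double integral
over `u, v ∈ [s, t]` of the modulus of the characteristic function of `ω_u - ω_v`, hence of `exp(-c'
|u - v|^{2H} ‖ξ‖²)`. Integrating against `‖ξ‖ ^ (2α)` gives a multiple of `|u - v|^{-θ}` with `θ = H
(2α + d)`, and the upper bound on `α` says exactly that `θ < 1`. The expected energy is therefore
`O((t - s)^{2 - θ})` (`exists_lintegral_pathEnergy_le`). As `2 - θ > 1`, the expected energies of
the `2 ^ n` dyadic intervals of level `n` sum to `O(2^{-n(1 - θ)})`, which leaves room for a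
geometric weight: a weighted sum over all dyadic intervals is almost surely finite
(`exists_ae_dyadicEnergy_ne_top`).

Passing from dyadic to arbitrary partitions is deterministic. For fixed `ξ`, the transform of
`μ_{a,t}` is continuous in `t` and is the limit of its dyadic step functions; chaining over the
levels bounds its quadratic variation along any partition by weighted dyadic increments
(`sum_enorm_sub_sq_le_tsum_dyadic`). The bound does not depend on the partition, so it can be
integrated in `ξ`. -/

noncomputable section

namespace SmallBall

section FourierAnalysis

open scoped FourierTransform SchwartzMap ContDiff

/-! ### Plancherel's theorem for integrable functions -/

/-- The Fourier transform of an `L¹ ∩ L²` function, defined by an integral, agrees almost everywhere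
with its `L²` Fourier transform. -/
theorem coeFn_fourier_toLp {E : Type*} [NormedAddCommGroup E] [InnerProductSpace ℝ E]
    [FiniteDimensional ℝ E] [MeasurableSpace E] [BorelSpace E] {f : E → ℂ}
    (hf1 : Integrable f) (hf2 : MemLp f 2) :
    ((𝓕 (hf2.toLp f) : Lp (α := E) ℂ 2) : E → ℂ) =ᵐ[volume] 𝓕 f := by
  apply ae_eq_of_integral_contDiff_smul_eq
  · exact ((Lp.memLp _).locallyIntegrable (by norm_num))
  · exact (VectorFourier.fourierIntegral_continuous Real.continuous_fourierChar
      (L := innerₗ E) continuous_inner hf1).locallyIntegrable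
  intro g hg hgs
  have hgs' : HasCompactSupport (fun x => (g x : ℂ)) := hgs.comp_left (g := fun x : ℝ => (x : ℂ)) rfl
  have hg' : ContDiff ℝ ∞ (fun x => (g x : ℂ)) := Complex.ofRealCLM.contDiff.comp hg
  -- Viewed as a Schwartz function, the test function can exchange its transform with either version
  -- of the transform of `f`: both pairings equal `∫ 𝓕 φ • f`.
  set φ : 𝓢(E, ℂ) := hgs'.toSchwartzMap hg' with hφ
  have hφx : ∀ x, φ x = g x := fun x => rfl
  have h1 := congrArg (fun T : 𝓢'(E, ℂ) => T φ) (Lp.fourier_toTemperedDistribution_eq (hf2.toLp f))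
  simp only [TemperedDistribution.fourier_apply, Lp.toTemperedDistribution_apply] at h1
  have h2 : ∫ x, (𝓕 φ : 𝓢(E, ℂ)) x • (hf2.toLp f) x = ∫ x, (𝓕 φ : 𝓢(E, ℂ)) x • f x := by
    apply integral_congr_ae
    filter_upwards [hf2.coeFn_toLp] with x hx
    rw [hx]
  have h3 : ∫ x, (𝓕 φ : 𝓢(E, ℂ)) x • f x = ∫ x, φ x • 𝓕 f x := by
    have := VectorFourier.integral_fourierIntegral_smul_eq_flip (L := innerₗ E) (μ := volume)
      (ν := volume) Real.continuous_fourierChar continuous_inner φ.integrable hf1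
    simp only [flip_innerₗ] at this
    exact this
  rw [h2, h3] at h1
  simp only [hφx] at h1
  simpa using h1.symm

/-- Plancherel's theorem for `L¹ ∩ L²` functions. -/
theorem eLpNorm_fourier_eq {E : Type*} [NormedAddCommGroup E] [InnerProductSpace ℝ E]
    [FiniteDimensional ℝ E] [MeasurableSpace E] [BorelSpace E] {f : E → ℂ}
    (hf1 : Integrable f) (hf2 : MemLp f 2) :
    eLpNorm (𝓕 f) 2 volume = eLpNorm f 2 volume := by
  rw [← eLpNorm_congr_ae (coeFn_fourier_toLp hf1 hf2), ← eLpNorm_congr_ae hf2.coeFn_toLp,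
    ← Lp.enorm_def, ← Lp.enorm_def, ← ofReal_norm, ← ofReal_norm, Lp.norm_fourier_eq]

/-! ### Cancellation in `Δ_k` and the Fourier transform of balls -/

/-- `Δ_k F (r)` is a fixed linear combination of the values `F (r / 2 ^ j)`. -/
theorem exists_deltaOp_eq_sum (k : ℕ) : ∃ c : ℕ → ℝ, ∀ (F : ℝ → ℝ) (r : ℝ),
    deltaOp k F r = ∑ j ∈ Finset.range (k + 2), c j * F (r / 2 ^ j) := by
  induction k with
  | zero =>
    refine ⟨fun j => if j = 0 then 1 else -1, fun F r => ?_⟩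
    simp [deltaOp, Finset.sum_range_succ, sub_eq_add_neg]
  | succ k ih =>
    obtain ⟨c, hc⟩ := ih
    refine ⟨fun j => (if j < k + 2 then c j else 0) -
      (if j = 0 then 0 else 2 ^ (k + 1) * c (j - 1)), fun F r => ?_⟩
    have h1 : ∑ j ∈ Finset.range (k + 1 + 2), (if j < k + 2 then c j else 0) * F (r / 2 ^ j)
        = ∑ j ∈ Finset.range (k + 2), c j * F (r / 2 ^ j) := by
      rw [Finset.sum_range_succ]
      simp only [lt_irrefl, if_false, zero_mul, add_zero]
      refine Finset.sum_congr rfl fun j hj => ?_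
      rw [if_pos (Finset.mem_range.1 hj)]
    have h2 : ∑ j ∈ Finset.range (k + 1 + 2),
        (if j = 0 then 0 else 2 ^ (k + 1) * c (j - 1)) * F (r / 2 ^ j)
        = 2 ^ (k + 1) * ∑ j ∈ Finset.range (k + 2), c j * F (r / 2 / 2 ^ j) := by
      rw [Finset.sum_range_succ', Finset.mul_sum]
      simp [pow_succ', div_div, mul_assoc]
    simp only [deltaOp, hc, sub_mul, Finset.sum_sub_distrib, h1, h2]

/-- `Δ_k` annihilates `r ^ m` for `m ≤ k`. -/
theorem deltaOp_pow_eq_zero {k m : ℕ} (hm : m ≤ k) (r : ℝ) : deltaOp k (fun r => r ^ m) r = 0 := by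
  -- `r ^ m` is an eigenfunction; passing from `k` to `k + 1` multiplies the eigenvalue by `1 - 2 ^
  -- (k + 1 - m)`, which vanishes when `m = k + 1`.
  have key : ∀ k : ℕ, ∃ κ : ℝ, (m ≤ k → κ = 0) ∧ ∀ r, deltaOp k (fun r => r ^ m) r = κ * r ^ m := by
    intro k
    induction k with
    | zero =>
      refine ⟨1 - (1 / 2) ^ m, fun h => ?_, fun r => ?_⟩
      · simp [Nat.le_zero.1 h]
      · simp only [deltaOp, div_pow]; ring
    | succ k ih =>
      obtain ⟨κ, hκ, hr⟩ := ih
      refine ⟨κ * (1 - 2 ^ (k + 1) * (1 / 2) ^ m), fun h => ?_, fun r => ?_⟩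
      · rcases Nat.le_succ_iff.1 h with h | h
        · simp [hκ h]
        · simp [h]
      · simp only [deltaOp, hr, div_pow]; ring
  obtain ⟨κ, hκ, hr⟩ := key k
  rw [hr, hκ hm, zero_mul]

/-- `∫_{|z| ≤ ρ} e^{2πi⟨z, ξ⟩} dz`, the Fourier transform of the indicator function of a ball. -/
def ballFourier {d : ℕ} (ρ : ℝ) (ξ : Rd d) : ℂ :=
  ∫ z in Metric.closedBall (0 : Rd d) ρ, Complex.exp ((2 * Real.pi * inner ℝ z ξ : ℝ) * Complex.I)

theorem norm_exp_mul_I_le (x : ℝ) : ‖Complex.exp ((x : ℂ) * Complex.I)‖ ≤ 1 :=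
  (Complex.norm_exp_ofReal_mul_I x).le

theorem integrableOn_ball_exp {d : ℕ} (ρ : ℝ) (ξ : Rd d) :
    IntegrableOn (fun z => Complex.exp ((2 * Real.pi * inner ℝ z ξ : ℝ) * Complex.I))
      (Metric.closedBall (0 : Rd d) ρ) :=
  ContinuousOn.integrableOn_compact (isCompact_closedBall _ _) (by fun_prop)

theorem ballFourier_eq {d : ℕ} {ρ : ℝ} (hρ : 0 < ρ) (ξ : Rd d) :
    ballFourier ρ ξ = (ρ : ℂ) ^ d * ballFourier 1 (ρ • ξ) := by
  unfold ballFourier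
  have h := Measure.setIntegral_comp_smul_of_pos (volume : Measure (Rd d))
    (fun z => Complex.exp ((2 * Real.pi * inner ℝ z ξ : ℝ) * Complex.I))
    (Metric.closedBall (0 : Rd d) 1) hρ
  rw [smul_closedBall _ _ zero_le_one, smul_zero, Real.norm_of_nonneg hρ.le, mul_one,
    finrank_euclideanSpace_fin] at h
  have h2 : ∀ z : Rd d, inner ℝ z (ρ • ξ) = inner ℝ (ρ • z) ξ := fun z => by
    rw [inner_smul_left, inner_smul_right]; rfl
  simp only [h2, h]
  have : (ρ : ℂ) ^ d ≠ 0 := pow_ne_zero _ (by exact_mod_cast hρ.ne')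
  rw [Complex.real_smul, Complex.ofReal_inv, Complex.ofReal_pow, mul_inv_cancel_left₀ this]

/-- Moments of the unit ball. -/
def ballMoment {d : ℕ} (m : ℕ) (η : Rd d) : ℂ :=
  ∫ z in Metric.closedBall (0 : Rd d) 1,
    ((2 * Real.pi * inner ℝ z η : ℝ) * Complex.I) ^ m / (m.factorial : ℂ)

theorem ballMoment_smul {d : ℕ} (m : ℕ) (t : ℝ) (η : Rd d) :
    ballMoment m (t • η) = (t : ℂ) ^ m * ballMoment m η := by
  unfold ballMoment
  rw [← integral_const_mul]
  congr 1
  ext z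
  rw [inner_smul_right]
  push_cast
  ring

/-- The reflection `z ↦ -z` preserves the ball. Hence `Δ_k` only has to cancel the moments of even
order. -/
theorem ballMoment_odd {d : ℕ} {m : ℕ} (hm : Odd m) (η : Rd d) : ballMoment m η = 0 := by
  have h : ballMoment m η = - ballMoment m η := by
    conv_lhs => rw [ballMoment, ← integral_indicator measurableSet_closedBall,
      ← integral_neg_eq_self]
    rw [ballMoment, ← integral_indicator measurableSet_closedBall, ← integral_neg]
    congr 1
    ext z
    by_cases hz : ‖z‖ ≤ 1
    · simp only [indicator, Metric.mem_closedBall, dist_zero_right, norm_neg, hz, if_true,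
        inner_neg_left, mul_neg, Complex.ofReal_neg, neg_mul, hm.neg_pow, neg_div]
    · simp [indicator, hz]
  exact self_eq_neg.1 h

/-- Taylor's formula for the exponential, integrated over the unit ball; there the argument has
modulus at most `2 * π`. -/
theorem norm_ballFourier_sub_le {d : ℕ} (N : ℕ) (η : Rd d) (hη : ‖η‖ ≤ 1) :
    ‖ballFourier 1 η - ∑ m ∈ Finset.range N, ballMoment m η‖ ≤
      (2 * Real.pi) ^ N * Real.exp (2 * Real.pi) *
        volume.real (Metric.closedBall (0 : Rd d) 1) * ‖η‖ ^ N := by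
  have hint : ∀ m ∈ Finset.range N, IntegrableOn (fun z : Rd d =>
      ((2 * Real.pi * inner ℝ z η : ℝ) * Complex.I) ^ m / (m.factorial : ℂ))
      (Metric.closedBall (0 : Rd d) 1) := fun m _ =>
    ContinuousOn.integrableOn_compact (isCompact_closedBall _ _) (by fun_prop)
  unfold ballFourier ballMoment
  rw [← integral_finsetSum _ hint, ← integral_sub (integrableOn_ball_exp _ _)
    (integrable_finsetSum _ hint)]
  have hb : ∀ z ∈ Metric.closedBall (0 : Rd d) 1,
      ‖Complex.exp ((2 * Real.pi * inner ℝ z η : ℝ) * Complex.I) - ∑ m ∈ Finset.range N,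
        ((2 * Real.pi * inner ℝ z η : ℝ) * Complex.I) ^ m / (m.factorial : ℂ)‖
      ≤ (2 * Real.pi) ^ N * Real.exp (2 * Real.pi) * ‖η‖ ^ N := by
    intro z hz
    have hz' : ‖z‖ ≤ 1 := by simpa using hz
    refine (Complex.norm_exp_sub_sum_le_norm_mul_exp _ N).trans ?_
    have h1 : ‖((2 * Real.pi * inner ℝ z η : ℝ) : ℂ) * Complex.I‖ ≤ 2 * Real.pi * ‖η‖ := by
      rw [norm_mul, Complex.norm_I, mul_one, Complex.norm_real, norm_mul,
        Real.norm_of_nonneg (by positivity)]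
      gcongr
      calc ‖inner ℝ z η‖ ≤ ‖z‖ * ‖η‖ := norm_inner_le_norm _ _
        _ ≤ 1 * ‖η‖ := by gcongr
        _ = ‖η‖ := one_mul _
    calc _ ≤ (2 * Real.pi * ‖η‖) ^ N * Real.exp (2 * Real.pi * 1) := by
            gcongr
            exact h1.trans (by gcongr)
      _ = _ := by rw [mul_pow]; ring_nf
  refine (norm_setIntegral_le_of_norm_le_const
    (isCompact_closedBall _ _).measure_lt_top hb).trans_eq ?_
  ring

theorem norm_ballFourier_one_le {d : ℕ} (η : Rd d) :
    ‖ballFourier 1 η‖ ≤ volume.real (Metric.closedBall (0 : Rd d) 1) := by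
  refine (norm_setIntegral_le_of_norm_le_const
    (isCompact_closedBall _ _).measure_lt_top fun z _ => norm_exp_mul_I_le _).trans_eq ?_
  rw [one_mul]

/-- Decay of the Fourier transform of `Δ_k` of the indicator function of a ball. -/
theorem exists_norm_sum_ballFourier_le {d k J : ℕ} (c : ℕ → ℝ)
    (hc : ∀ (F : ℝ → ℝ) (r : ℝ),
      deltaOp k F r = ∑ j ∈ Finset.range (k + 2), c j * F (r / 2 ^ j))
    (hJ : ∀ j < J, d + 2 * j ≤ k) :
    ∃ C : ℝ, 0 ≤ C ∧ ∀ (r : ℝ) (ξ : Rd d), 0 < r →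
      ‖∑ j ∈ Finset.range (k + 2), (c j : ℂ) * ballFourier (r / 2 ^ j) ξ‖ ≤
        C * r ^ d * min 1 ((r * ‖ξ‖) ^ (2 * J)) := by
  set V := volume.real (Metric.closedBall (0 : Rd d) 1) with hV
  set S := ∑ j ∈ Finset.range (k + 2), |c j| with hS
  set A := (2 * Real.pi) ^ (2 * J) * Real.exp (2 * Real.pi) * V with hA
  have hV0 : 0 ≤ V := measureReal_nonneg
  have hA0 : 0 ≤ A := by positivity
  have hS0 : 0 ≤ S := by positivity
  have hpow : ∀ j : ℕ, ((1 : ℝ) / 2 ^ j) ≤ 1 := fun j => by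
    rw [div_le_one (by positivity)]; exact one_le_pow₀ (by norm_num)
  refine ⟨S * (V + A), by positivity, fun r ξ hr => ?_⟩
  set η := r • ξ with hη
  have hηn : ‖η‖ = r * ‖ξ‖ := by rw [norm_smul, Real.norm_of_nonneg hr.le]
  have hB : ∀ j : ℕ, ballFourier (r / 2 ^ j) ξ
      = (r : ℂ) ^ d * ((1 / 2 ^ j : ℝ) : ℂ) ^ d * ballFourier 1 ((1 / 2 ^ j : ℝ) • η) := by
    intro j
    rw [ballFourier_eq (by positivity), hη, smul_smul, one_div_mul_eq_div, ← mul_pow]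
    push_cast
    rw [mul_one_div]
  have key : ‖∑ j ∈ Finset.range (k + 2), (c j : ℂ) *
      (((1 / 2 ^ j : ℝ) : ℂ) ^ d * ballFourier 1 ((1 / 2 ^ j : ℝ) • η))‖
      ≤ S * (V + A) * min 1 (‖η‖ ^ (2 * J)) := by
    rcases le_or_gt ‖η‖ 1 with h1 | h1
    · rw [min_eq_right (pow_le_one₀ (norm_nonneg _) h1)]
      -- The Taylor polynomial is annihilated: by homogeneity its term of order `m` carries the
      -- factor `∑ c j * 2 ^ (-j (d + m))`, the value at `1` of `Δ_k` applied to `r ^ (d + m)`. Only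
      -- the Taylor remainder survives.
      have hz : ∑ j ∈ Finset.range (k + 2), (c j : ℂ) * (((1 / 2 ^ j : ℝ) : ℂ) ^ d *
          ∑ m ∈ Finset.range (2 * J), ballMoment m ((1 / 2 ^ j : ℝ) • η)) = 0 := by
        simp only [Finset.mul_sum]
        rw [Finset.sum_comm]
        refine Finset.sum_eq_zero fun m hm => ?_
        rcases Nat.even_or_odd m with he | ho
        · obtain ⟨i, rfl⟩ := he
          have hi : d + (i + i) ≤ k := by
            have := hJ i (by rw [Finset.mem_range] at hm; omega)
            omega
          have h0 : ∑ j ∈ Finset.range (k + 2), c j * (1 / 2 ^ j : ℝ) ^ (d + (i + i)) = 0 := by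
            rw [← hc (fun r => r ^ (d + (i + i))) 1]
            exact deltaOp_pow_eq_zero hi 1
          have h0' : ∑ j ∈ Finset.range (k + 2),
              (c j : ℂ) * ((1 / 2 ^ j : ℝ) : ℂ) ^ (d + (i + i)) = 0 := by exact_mod_cast h0
          calc _ = (∑ j ∈ Finset.range (k + 2),
              (c j : ℂ) * ((1 / 2 ^ j : ℝ) : ℂ) ^ (d + (i + i))) * ballMoment (i + i) η := by
                rw [Finset.sum_mul]
                refine Finset.sum_congr rfl fun j _ => ?_
                rw [ballMoment_smul]
                ring
            _ = 0 := by rw [h0', zero_mul]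
        · simp [ballMoment_odd ho]
      rw [← sub_zero (∑ j ∈ Finset.range (k + 2), _), ← hz, ← Finset.sum_sub_distrib]
      calc _ ≤ ∑ j ∈ Finset.range (k + 2), |c j| * ((V + A) * ‖η‖ ^ (2 * J)) := by
            refine norm_sum_le_of_le _ fun j _ => ?_
            rw [← mul_sub, ← mul_sub, norm_mul, norm_mul, Complex.norm_real, Real.norm_eq_abs,
              norm_pow, Complex.norm_real, Real.norm_of_nonneg (by positivity)]
            have hle : ‖(1 / 2 ^ j : ℝ) • η‖ ≤ ‖η‖ := by
              rw [norm_smul, Real.norm_of_nonneg (by positivity)]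
              exact mul_le_of_le_one_left (norm_nonneg _) (hpow j)
            refine mul_le_mul_of_nonneg_left ?_ (abs_nonneg _)
            calc _ ≤ 1 * (A * ‖(1 / 2 ^ j : ℝ) • η‖ ^ (2 * J)) := by
                  gcongr
                  · exact pow_le_one₀ (by positivity) (hpow j)
                  · exact norm_ballFourier_sub_le _ _ (hle.trans h1)
              _ ≤ (V + A) * ‖η‖ ^ (2 * J) := by
                  rw [one_mul]
                  gcongr
                  linarith
        _ = _ := by rw [← Finset.sum_mul]; ring
    · rw [min_eq_left (one_le_pow₀ h1.le), mul_one, hS, Finset.sum_mul]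
      refine norm_sum_le_of_le _ fun j _ => ?_
      rw [norm_mul, norm_mul, Complex.norm_real, Real.norm_eq_abs,
              norm_pow, Complex.norm_real, Real.norm_of_nonneg (by positivity)]
      gcongr
      calc _ ≤ 1 * V := by
            gcongr
            · exact pow_le_one₀ (by positivity) (hpow j)
            · exact norm_ballFourier_one_le _
        _ ≤ V + A := by linarith
  calc _ = ‖(r : ℂ) ^ d * ∑ j ∈ Finset.range (k + 2), (c j : ℂ) *
      (((1 / 2 ^ j : ℝ) : ℂ) ^ d * ballFourier 1 ((1 / 2 ^ j : ℝ) • η))‖ := by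
        rw [Finset.mul_sum]
        congr 1
        refine Finset.sum_congr rfl fun j _ => ?_
        rw [hB]
        ring
    _ ≤ r ^ d * (S * (V + A) * min 1 (‖η‖ ^ (2 * J))) := by
        rw [norm_mul, norm_pow, Complex.norm_real, Real.norm_of_nonneg hr.le]
        gcongr
    _ = _ := by rw [hηn]; ring

/-! ### Plancherel's theorem for the masses of balls -/

theorem ballFun_toSignedMeasure {d : ℕ} (μ : Measure (Rd d)) [IsFiniteMeasure μ] (r : ℝ)
    (y : Rd d) : ballFun μ.toSignedMeasure r y = μ.real (Metric.closedBall y r) :=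
  Measure.toSignedMeasure_apply_measurable measurableSet_closedBall

theorem measurable_measureReal_closedBall {d : ℕ} (μ : Measure (Rd d)) [SFinite μ] :
    Measurable fun p : Rd d × ℝ => μ.real (Metric.closedBall p.1 p.2) := by
  have : MeasurableSet {q : (Rd d × ℝ) × Rd d | dist q.2 q.1.1 ≤ q.1.2} :=
    measurableSet_le (by fun_prop) (by fun_prop)
  exact (measurable_measure_prodMk_left (ν := μ) this).ennreal_toReal

theorem integrable_indicator_ball_prod {d : ℕ} (μ : Measure (Rd d)) [IsFiniteMeasure μ] (ρ : ℝ) :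
    Integrable ({q : Rd d × Rd d | dist q.1 q.2 ≤ ρ}.indicator fun _ => (1 : ℝ))
      (μ.prod volume) := by
  have hm : MeasurableSet {q : Rd d × Rd d | dist q.1 q.2 ≤ ρ} :=
    measurableSet_le (by fun_prop) (by fun_prop)
  rw [integrable_indicator_iff hm, integrableOn_const_iff]
  right
  rw [Measure.prod_apply hm]
  have : ∀ x : Rd d, volume (Prod.mk x ⁻¹' {q : Rd d × Rd d | dist q.1 q.2 ≤ ρ})
      = volume (Metric.closedBall (0 : Rd d) ρ) := by
    intro x
    rw [← Measure.addHaar_closedBall_center volume x ρ]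
    congr 1
    ext y
    simp [dist_comm]
  simp only [this, lintegral_const]
  exact ENNReal.mul_lt_top (isCompact_closedBall _ _).measure_lt_top (measure_lt_top _ _)

theorem measureReal_closedBall_eq_integral {d : ℕ} (μ : Measure (Rd d)) (ρ : ℝ) (y : Rd d) :
    μ.real (Metric.closedBall y ρ) =
      ∫ x, ({q : Rd d × Rd d | dist q.1 q.2 ≤ ρ}.indicator (fun _ => (1 : ℝ)) (x, y)) ∂μ := by
  have : (fun x => {q : Rd d × Rd d | dist q.1 q.2 ≤ ρ}.indicator (fun _ => (1 : ℝ)) (x, y))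
      = (Metric.closedBall y ρ).indicator 1 := by
    ext x; simp [indicator]
  rw [this, integral_indicator_one measurableSet_closedBall]

theorem integrable_measureReal_closedBall {d : ℕ} (μ : Measure (Rd d)) [IsFiniteMeasure μ]
    (ρ : ℝ) : Integrable fun y : Rd d => μ.real (Metric.closedBall y ρ) := by
  simp only [measureReal_closedBall_eq_integral μ ρ]
  exact (integrable_indicator_ball_prod μ ρ).integral_prod_right

/-- The Fourier transform of `y ↦ μ {x : |x - y| ≤ ρ}`. -/
theorem fourier_measureReal_closedBall {d : ℕ} (μ : Measure (Rd d)) [IsFiniteMeasure μ]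
    (ρ : ℝ) (ξ : Rd d) :
    𝓕 (fun y : Rd d => (μ.real (Metric.closedBall y ρ) : ℂ)) ξ
      = charFun μ (-(2 * Real.pi) • ξ) * ballFourier ρ ξ := by
  set e : Rd d → ℂ := fun z => Complex.exp ((2 * Real.pi * inner ℝ z ξ : ℝ) * Complex.I) with he
  set S : Set (Rd d × Rd d) := {q | dist q.1 q.2 ≤ ρ} with hS
  have hm : MeasurableSet S := measurableSet_le (by fun_prop) (by fun_prop)
  have hint : Integrable (fun q : Rd d × Rd d => S.indicator (fun q => e (-q.2)) q)
      (μ.prod volume) := by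
    refine (integrable_indicator_ball_prod μ ρ).mono' ?_ (Filter.Eventually.of_forall fun q => ?_)
    · exact Measurable.aestronglyMeasurable (Measurable.indicator (by fun_prop) hm)
    · by_cases hq : q ∈ S
      · rw [indicator_of_mem hq, indicator_of_mem hq]; exact norm_exp_mul_I_le _
      · rw [indicator_of_notMem hq, indicator_of_notMem hq, norm_zero]
  rw [Real.fourier_eq']
  calc _ = ∫ y, (∫ x, S.indicator (fun q => e (-q.2)) (x, y) ∂μ) := by
        congr 1
        ext y
        rw [measureReal_closedBall_eq_integral, ← integral_complex_ofReal, smul_eq_mul,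
          ← integral_const_mul]
        congr 1
        ext x
        by_cases hq : (x, y) ∈ S
        · rw [indicator_of_mem hq, indicator_of_mem hq]
          simp [he]
        · rw [indicator_of_notMem hq, indicator_of_notMem hq]; simp
    _ = ∫ x, (∫ y, S.indicator (fun q => e (-q.2)) (x, y)) ∂μ := (integral_integral_swap hint).symm
    _ = ∫ x, e (-x) * ballFourier ρ ξ ∂μ := by
        congr 1
        ext x
        -- After substituting `y = x - z`, the phase splits as `e (-x) * e z` and the constraint
        -- becomes `‖z‖ ≤ ρ`.
        rw [← integral_sub_left_eq_self _ volume x, ballFourier,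
          ← integral_indicator measurableSet_closedBall, ← integral_const_mul]
        congr 1
        ext z
        by_cases hz : ‖z‖ ≤ ρ
        · rw [indicator_of_mem (by simpa [hS, dist_eq_norm] using hz),
            indicator_of_mem (by simpa using hz)]
          simp only [he, ← Complex.exp_add]
          congr 1
          simp only [inner_neg_left, inner_sub_left]
          push_cast
          ring
        · rw [indicator_of_notMem (by simpa [hS, dist_eq_norm] using hz),
            indicator_of_notMem (by simpa using hz), mul_zero]
    _ = _ := by
        rw [integral_mul_const, charFun_apply]
        congr 2
        ext x
        simp only [he, inner_neg_left, inner_smul_right]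
        congr 1
        push_cast
        ring

/-- Plancherel's theorem for finite linear combinations of the functions
`y ↦ μ {x : |x - y| ≤ ρ}`. -/
theorem lintegral_sum_measureReal_closedBall {d : ℕ} (μ : Measure (Rd d)) [IsFiniteMeasure μ]
    (s : Finset ℕ) (c ρ : ℕ → ℝ) :
    ∫⁻ y, ‖∑ j ∈ s, c j * μ.real (Metric.closedBall y (ρ j))‖ₑ ^ 2 =
      ∫⁻ ξ, ‖charFun μ (-(2 * Real.pi) • ξ)‖ₑ ^ 2 *
        ‖∑ j ∈ s, (c j : ℂ) * ballFourier (ρ j) ξ‖ₑ ^ 2 := by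
  set f : Rd d → ℂ := fun y => ∑ j ∈ s, (c j : ℂ) * (μ.real (Metric.closedBall y (ρ j)) : ℂ)
    with hf
  have hterm : ∀ j, Integrable fun y : Rd d =>
      (c j : ℂ) * (μ.real (Metric.closedBall y (ρ j)) : ℂ) := fun j =>
    (integrable_measureReal_closedBall μ (ρ j)).ofReal.const_mul _
  have hf1 : Integrable f := integrable_finsetSum _ fun j _ => hterm j
  have hbdd : ∀ y, ‖f y‖ ≤ ∑ j ∈ s, |c j| * μ.real univ := fun y => by
    refine norm_sum_le_of_le _ fun j _ => ?_
    rw [norm_mul, Complex.norm_real, Complex.norm_real, Real.norm_eq_abs,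
      Real.norm_of_nonneg measureReal_nonneg]
    gcongr
    · exact measure_ne_top _ _
    · exact subset_univ _
  have hf2 : MemLp f 2 := by
    rw [memLp_two_iff_integrable_sq_norm hf1.aestronglyMeasurable]
    refine (hf1.norm.const_mul (∑ j ∈ s, |c j| * μ.real univ)).mono'
      (hf1.aestronglyMeasurable.norm.pow 2) (Filter.Eventually.of_forall fun y => ?_)
    rw [norm_pow, norm_norm, sq]
    exact mul_le_mul_of_nonneg_right (hbdd y) (norm_nonneg _)
  have hF : ∀ ξ, 𝓕 f ξ = charFun μ (-(2 * Real.pi) • ξ) *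
      ∑ j ∈ s, (c j : ℂ) * ballFourier (ρ j) ξ := by
    intro ξ
    rw [Finset.mul_sum, Real.fourier_eq]
    simp only [hf, Finset.smul_sum]
    rw [integral_finsetSum]
    · refine Finset.sum_congr rfl fun j _ => ?_
      rw [mul_left_comm, ← fourier_measureReal_closedBall, Real.fourier_eq, ← integral_const_mul]
      congr 1
      ext y
      simp only [Circle.smul_def, smul_eq_mul]
      ring
    · intro j _
      exact (Real.fourierIntegral_convergent_iff ξ).2 (hterm j)
  have h := congrArg (· ^ 2) (eLpNorm_fourier_eq hf1 hf2)
  have h2 : ∀ g : Rd d → ℂ, eLpNorm g 2 volume ^ 2 = ∫⁻ x, ‖g x‖ₑ ^ 2 := fun g => by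
    have := eLpNorm_nnreal_pow_eq_lintegral (f := g) (μ := volume) (p := 2) two_ne_zero
    simpa using this
  simp only [h2, hF, enorm_mul, mul_pow] at h
  rw [h]
  congr 1
  ext y
  have : f y = ((∑ j ∈ s, c j * μ.real (Metric.closedBall y (ρ j)) : ℝ) : ℂ) := by
    simp only [hf]
    push_cast
    rfl
  rw [this, ← ofReal_norm, ← ofReal_norm, Complex.norm_real]

/-! ### Comparison of the norm with a homogeneous Sobolev norm -/

instance : SFinite scaleMeasure := by
  unfold scaleMeasure; infer_instance

theorem lintegral_scaleMeasure (g : ℝ → ℝ≥0∞) (hg : Measurable g) :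
    ∫⁻ r, g r ∂scaleMeasure = ∫⁻ r in Ioi (0 : ℝ), ENNReal.ofReal r⁻¹ * g r := by
  rw [scaleMeasure, lintegral_withDensity_eq_lintegral_mul _ (by fun_prop) hg]
  rfl

theorem ae_scaleMeasure_pos : ∀ᵐ r ∂scaleMeasure, 0 < r := by
  have : scaleMeasure ≪ volume.restrict (Ioi (0 : ℝ)) := withDensity_absolutelyContinuous _ _
  exact this.ae_le (ae_restrict_mem measurableSet_Ioi)

theorem eLpNorm_two_sq {X E : Type*} [MeasurableSpace X] [TopologicalSpace E]
    [ContinuousENorm E] (f : X → E) (μ : Measure X) :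
    eLpNorm f 2 μ ^ 2 = ∫⁻ x, ‖f x‖ₑ ^ 2 ∂μ := by
  have := eLpNorm_nnreal_pow_eq_lintegral (f := f) (μ := μ) (p := 2) two_ne_zero
  simpa using this

theorem sbeNorm_two_two_sq {d : ℕ} (α : ℝ) (μ : SignedMeasure (Rd d)) :
    sbeNorm α 2 2 μ ^ 2 = ∫⁻ y, ∫⁻ r, ‖r ^ (-α - (d : ℝ)) *
      deltaOp ⌈α + (d : ℝ) - 1⌉₊ (fun r' => ballFun μ r' y) r‖ₑ ^ 2 ∂scaleMeasure := by
  rw [sbeNorm, eLpNorm_two_sq]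
  simp only [enorm_eq_self, eLpNorm_two_sq]

/-- The scaling integral `∫ r^{-2α} min(1, (rs)^N)² dr/r` is at most a multiple of `s^{2α}`. -/
theorem exists_lintegral_scaleMeasure_le {α : ℝ} {N : ℕ} (hα : 0 < α) (hN : α < N) :
    ∃ K : ℝ, 0 ≤ K ∧ ∀ s : ℝ, 0 < s →
      ∫⁻ r, ENNReal.ofReal ((r ^ (-α) * min 1 ((r * s) ^ N)) ^ 2) ∂scaleMeasure ≤
        ENNReal.ofReal (K * s ^ (2 * α)) := by
  -- The two terms come from splitting at `r = s⁻¹`: below, `r ^ (2N - 2α) dr/r` converges as `α <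
  -- N`; above, `r ^ (-2α) dr/r` converges as `α > 0`.
  refine ⟨1 / (2 * N - 2 * α) + 1 / (2 * α),
    add_nonneg (one_div_nonneg.2 (by linarith)) (by positivity), fun s hs => ?_⟩
  have hs' : 0 < s⁻¹ := inv_pos.2 hs
  rw [lintegral_scaleMeasure _ (by fun_prop), ← Ioc_union_Ioi_eq_Ioi hs'.le,
    lintegral_union measurableSet_Ioi (Ioc_disjoint_Ioi le_rfl), add_mul,
    ENNReal.ofReal_add (mul_nonneg (one_div_nonneg.2 (by linarith)) (by positivity))
      (by positivity)]
  have hp : ∀ r : ℝ, 0 < r → r⁻¹ * (r ^ (-α)) ^ 2 = r ^ (-1 - 2 * α) := fun r hr => by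
    rw [sub_eq_add_neg, Real.rpow_add hr, Real.rpow_neg_one, ← Real.rpow_natCast (r ^ (-α)) 2,
      ← Real.rpow_mul hr.le]
    congr 2
    push_cast; ring
  refine add_le_add ?_ ?_
  · have hexp : -1 < 2 * (N : ℝ) - 1 - 2 * α := by linarith
    have hii : IntervalIntegrable (fun r : ℝ => s ^ (2 * N) * r ^ (2 * (N : ℝ) - 1 - 2 * α))
        volume 0 s⁻¹ := (intervalIntegral.intervalIntegrable_rpow' hexp).const_mul _
    calc _ ≤ ∫⁻ r in Ioc 0 s⁻¹, ENNReal.ofReal (s ^ (2 * N) * r ^ (2 * (N : ℝ) - 1 - 2 * α)) := by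
          refine setLIntegral_mono' measurableSet_Ioc fun r hr => ?_
          rw [← ENNReal.ofReal_mul (inv_nonneg.2 hr.1.le)]
          refine ENNReal.ofReal_le_ofReal ?_
          have hr0 := hr.1
          calc _ ≤ r⁻¹ * (r ^ (-α) * (r * s) ^ N) ^ 2 := by
                gcongr
                exact min_le_right _ _
            _ = s ^ (2 * N) * (r ^ (2 * N) * (r⁻¹ * (r ^ (-α)) ^ 2)) := by ring
            _ = _ := by
                rw [hp r hr0, ← Real.rpow_natCast r, ← Real.rpow_add hr0]
                congr 2
                push_cast; ring
      _ = _ := by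
          rw [← ofReal_integral_eq_lintegral_ofReal hii.1, ← intervalIntegral.integral_of_le hs'.le,
            intervalIntegral.integral_const_mul, integral_rpow (Or.inl hexp)]
          · congr 1
            rw [Real.zero_rpow (by linarith), sub_zero, Real.inv_rpow hs.le, ← Real.rpow_neg hs.le,
              ← Real.rpow_natCast s, mul_div_assoc', ← Real.rpow_add hs, one_div_mul_eq_div]
            congr 1
            · congr 1
              push_cast; ring
            · ring
          · filter_upwards [ae_restrict_mem measurableSet_Ioc] with r hr
            have := hr.1
            positivity
  · have hexp : -1 - 2 * α < -1 := by linarith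
    calc _ ≤ ∫⁻ r in Ioi s⁻¹, ENNReal.ofReal (r ^ (-1 - 2 * α)) := by
          refine setLIntegral_mono' measurableSet_Ioi fun r hr => ?_
          have hr0 : 0 < r := hs'.trans hr
          rw [← ENNReal.ofReal_mul (inv_nonneg.2 hr0.le), ← hp r hr0]
          refine ENNReal.ofReal_le_ofReal ?_
          gcongr
          exact mul_le_of_le_one_right (by positivity) (min_le_left _ _)
      _ = _ := by
          rw [← ofReal_integral_eq_lintegral_ofReal (integrableOn_Ioi_rpow_of_lt hexp hs'),
            integral_Ioi_rpow_of_lt hexp hs']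
          · congr 1
            rw [Real.inv_rpow hs.le, ← Real.rpow_neg hs.le,
              show -(-1 - 2 * α + 1) = 2 * α by ring, show -1 - 2 * α + 1 = -(2 * α) by ring,
              neg_div_neg_eq, one_div_mul_eq_div]
          · filter_upwards [ae_restrict_mem measurableSet_Ioi] with r hr
            have : 0 < r := hs'.trans hr
            positivity

theorem measurable_rpow_mul_deltaOp_ballFun {d : ℕ} (α : ℝ) (k : ℕ) (μ : Measure (Rd d))
    [IsFiniteMeasure μ] : Measurable fun p : Rd d × ℝ =>
      ‖p.2 ^ (-α - (d : ℝ)) * deltaOp k (fun r' => ballFun μ.toSignedMeasure r' p.1) p.2‖ₑ ^ 2 := by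
  obtain ⟨c, hc⟩ := exists_deltaOp_eq_sum k
  simp only [hc, ballFun_toSignedMeasure]
  have h : ∀ j : ℕ, Measurable fun p : Rd d × ℝ =>
      μ.real (Metric.closedBall p.1 (p.2 / 2 ^ j)) := fun j =>
    (measurable_measureReal_closedBall μ).comp
      (f := fun p : Rd d × ℝ => (p.1, p.2 / 2 ^ j)) (by fun_prop)
  fun_prop

/-- The `SBE^{α,2}_2` norm of a finite measure is controlled by its homogeneous Sobolev norm of
order `α`, written in terms of the characteristic function. -/
theorem exists_sbeNorm_sq_le {d : ℕ} {α : ℝ} (hα0 : 0 < α) (hαeven : ∀ n : ℕ, α ≠ 2 * (n : ℝ)) :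
    ∃ C : ℝ, 0 ≤ C ∧ ∀ (μ : Measure (Rd d)) [IsFiniteMeasure μ],
      sbeNorm α 2 2 μ.toSignedMeasure ^ 2 ≤ ENNReal.ofReal C *
        ∫⁻ ξ, ENNReal.ofReal (‖ξ‖ ^ (2 * α)) * ‖charFun μ (-(2 * Real.pi) • ξ)‖ₑ ^ 2 := by
  set k := ⌈α + (d : ℝ) - 1⌉₊ with hk
  set J := ⌊α / 2⌋₊ + 1 with hJ
  have hαJ : α < ((2 * J : ℕ) : ℝ) := by
    have := Nat.lt_floor_add_one (α / 2)
    rw [hJ]; push_cast; linarith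
  -- Here `α` must not be an even integer: `2j ≤ α` is then strict, so `d + 2j < α + d ≤ k + 1`.
  have hJk : ∀ j < J, d + 2 * j ≤ k := by
    intro j hj
    have h1 : (j : ℝ) ≤ α / 2 := (Nat.le_floor_iff (by positivity)).1 (Nat.lt_succ_iff.1 hj)
    have h2 : 2 * (j : ℝ) < α := lt_of_le_of_ne (by linarith) (hαeven j).symm
    have h3 := Nat.le_ceil (α + (d : ℝ) - 1)
    have h4 : ((d + 2 * j : ℕ) : ℝ) < ((k + 1 : ℕ) : ℝ) := by push_cast; linarith
    exact Nat.lt_succ_iff.1 (by exact_mod_cast h4)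
  obtain ⟨c, hc⟩ := exists_deltaOp_eq_sum k
  obtain ⟨A, hA, hAb⟩ := exists_norm_sum_ballFourier_le (d := d) c hc hJk
  obtain ⟨K, hK, hKb⟩ := exists_lintegral_scaleMeasure_le hα0 hαJ
  refine ⟨A ^ 2 * K, by positivity, fun μ _ => ?_⟩
  have hm : Measurable fun q : ℝ × Rd d =>
      ENNReal.ofReal ((q.1 ^ (-α) * min 1 ((q.1 * ‖q.2‖) ^ (2 * J))) ^ 2) := by fun_prop
  have hcf : Measurable fun ξ : Rd d => ‖charFun μ (-(2 * Real.pi) • ξ)‖ₑ ^ 2 := by fun_prop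
  rw [sbeNorm_two_two_sq, lintegral_lintegral_swap
    (measurable_rpow_mul_deltaOp_ballFun α k μ).aemeasurable]
  calc _ ≤ ∫⁻ r, (∫⁻ ξ : Rd d, ENNReal.ofReal (A ^ 2) *
        (‖charFun μ (-(2 * Real.pi) • ξ)‖ₑ ^ 2 *
          ENNReal.ofReal ((r ^ (-α) * min 1 ((r * ‖ξ‖) ^ (2 * J))) ^ 2))) ∂scaleMeasure := by
        refine lintegral_mono_ae ?_
        filter_upwards [ae_scaleMeasure_pos] with r hr
        simp only [← hk, hc, ballFun_toSignedMeasure, enorm_mul, mul_pow]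
        rw [lintegral_const_mul' _ _ (by finiteness), lintegral_sum_measureReal_closedBall,
          ← lintegral_const_mul' _ _ (by finiteness)]
        refine lintegral_mono fun ξ => ?_
        calc _ = ‖charFun μ (-(2 * Real.pi) • ξ)‖ₑ ^ 2 * (‖r ^ (-α - (d : ℝ))‖ₑ ^ 2 *
              ‖∑ j ∈ Finset.range (k + 2), (c j : ℂ) * ballFourier (r / 2 ^ j) ξ‖ₑ ^ 2) := by
              ring
          _ ≤ ‖charFun μ (-(2 * Real.pi) • ξ)‖ₑ ^ 2 * (ENNReal.ofReal (A ^ 2) *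
              ENNReal.ofReal ((r ^ (-α) * min 1 ((r * ‖ξ‖) ^ (2 * J))) ^ 2)) := by
              refine mul_le_mul' le_rfl ?_
              rw [← mul_pow, ← ofReal_norm, ← ofReal_norm, ← ENNReal.ofReal_mul (norm_nonneg _),
                ← ENNReal.ofReal_mul (by positivity), ← mul_pow,
                ← ENNReal.ofReal_pow (by positivity)]
              refine ENNReal.ofReal_le_ofReal (pow_le_pow_left₀ (by positivity) ?_ 2)
              rw [Real.norm_of_nonneg (by positivity)]
              calc _ ≤ r ^ (-α - (d : ℝ)) * (A * r ^ d * min 1 ((r * ‖ξ‖) ^ (2 * J))) := by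
                    gcongr
                    exact hAb r ξ hr
                _ = _ := by
                    rw [Real.rpow_sub hr, Real.rpow_natCast]
                    field_simp
          _ = _ := by simp only [mul_pow]; ring
    _ = ∫⁻ ξ : Rd d, (∫⁻ r, ENNReal.ofReal (A ^ 2) * (‖charFun μ (-(2 * Real.pi) • ξ)‖ₑ ^ 2 *
          ENNReal.ofReal ((r ^ (-α) * min 1 ((r * ‖ξ‖) ^ (2 * J))) ^ 2)) ∂scaleMeasure) :=
        lintegral_lintegral_swap
          ((hcf.comp measurable_snd).mul hm |>.const_mul _).aemeasurable
    _ ≤ ∫⁻ ξ : Rd d, ENNReal.ofReal (A ^ 2 * K) * (ENNReal.ofReal (‖ξ‖ ^ (2 * α)) *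
          ‖charFun μ (-(2 * Real.pi) • ξ)‖ₑ ^ 2) := by
        refine lintegral_mono fun ξ => ?_
        rw [lintegral_const_mul' _ _ (by finiteness), lintegral_const_mul' _ _ (by finiteness),
          ENNReal.ofReal_mul (by positivity)]
        have h : ∫⁻ r, ENNReal.ofReal ((r ^ (-α) * min 1 ((r * ‖ξ‖) ^ (2 * J))) ^ 2) ∂scaleMeasure
            ≤ ENNReal.ofReal K * ENNReal.ofReal (‖ξ‖ ^ (2 * α)) := by
          rw [← ENNReal.ofReal_mul hK]
          rcases eq_or_ne ξ 0 with rfl | hξ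
          -- At `ξ = 0` the integrand vanishes because `J ≥ 1`.
          · simp [hJ]
          · exact hKb _ (norm_pos_iff.2 hξ)
        calc _ ≤ ENNReal.ofReal (A ^ 2) * (‖charFun μ (-(2 * Real.pi) • ξ)‖ₑ ^ 2 *
              (ENNReal.ofReal K * ENNReal.ofReal (‖ξ‖ ^ (2 * α)))) := by gcongr
          _ = _ := by ring
    _ = _ := lintegral_const_mul' _ _ (by finiteness)

end FourierAnalysis

/-! ### Quadratic variation from dyadic increments -/

section Variation

open Filter Topology

/-- The Cauchy-Schwarz inequality for series in `[0, ∞]`. -/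
theorem tsum_mul_sq_le {ι : Type*} (f g : ι → ℝ≥0∞) :
    (∑' i, f i * g i) ^ 2 ≤ (∑' i, f i ^ 2) * ∑' i, g i ^ 2 := by
  let _ : MeasurableSpace ι := ⊤
  have h := ENNReal.lintegral_mul_le_Lp_mul_Lq (Measure.count : Measure ι)
    Real.HolderConjugate.two_two (f := f) (g := g)
    (measurable_from_top).aemeasurable (measurable_from_top).aemeasurable
  simp only [Pi.mul_apply, lintegral_count, ENNReal.rpow_ofNat] at h
  calc _ ≤ _ := pow_le_pow_left' h 2
    _ = _ := by
      rw [mul_pow, ← ENNReal.rpow_ofNat, ← ENNReal.rpow_ofNat, ← ENNReal.rpow_mul,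
        ← ENNReal.rpow_mul]
      norm_num

/-- The quadratic variation of a step function is controlled by the sum of its squared values. -/
theorem sum_norm_sub_sq_le {E : Type*} [SeminormedAddCommGroup E] (v : ℕ → E) {i : ℕ → ℕ}
    (hi : Monotone i) {N M : ℕ} (hM : ∀ h, i h < M) :
    ∑ h ∈ Finset.range N, ‖v (i (h + 1)) - v (i h)‖ ^ 2 ≤
      4 * ∑ k ∈ Finset.range M, ‖v k‖ ^ 2 := by
  -- Steps where the index does not move contribute nothing. On the others both `i` and `h ↦ i (h +
  -- 1)` are injective, so each `v k` occurs at most once at either end.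
  set S := (Finset.range N).filter fun h => i h < i (h + 1) with hS
  have h1 : ∑ h ∈ S, ‖v (i h)‖ ^ 2 ≤ ∑ k ∈ Finset.range M, ‖v k‖ ^ 2 := by
    rw [← Finset.sum_image (f := fun k => ‖v k‖ ^ 2) (g := i) (s := S)]
    · refine Finset.sum_le_sum_of_subset_of_nonneg ?_ fun _ _ _ => by positivity
      intro k hk
      obtain ⟨h, -, rfl⟩ := Finset.mem_image.1 hk
      exact Finset.mem_range.2 (hM h)
    · intro x hx y hy hxy
      simp only [hS, Finset.coe_filter, mem_ofPred_eq] at hx hy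
      rcases lt_trichotomy x y with h | h | h
      · have := hi (Nat.succ_le_of_lt h); simp only [Nat.succ_eq_add_one] at this; omega
      · exact h
      · have := hi (Nat.succ_le_of_lt h); simp only [Nat.succ_eq_add_one] at this; omega
  have h2 : ∑ h ∈ S, ‖v (i (h + 1))‖ ^ 2 ≤ ∑ k ∈ Finset.range M, ‖v k‖ ^ 2 := by
    rw [← Finset.sum_image (f := fun k => ‖v k‖ ^ 2) (g := fun h => i (h + 1)) (s := S)]
    · refine Finset.sum_le_sum_of_subset_of_nonneg ?_ fun _ _ _ => by positivity
      intro k hk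
      obtain ⟨h, -, rfl⟩ := Finset.mem_image.1 hk
      exact Finset.mem_range.2 (hM (h + 1))
    · intro x hx y hy hxy
      simp only [hS, Finset.coe_filter, mem_ofPred_eq] at hx hy hxy
      rcases lt_trichotomy x y with h | h | h
      · have := hi (Nat.succ_le_of_lt h); simp only [Nat.succ_eq_add_one] at this; omega
      · exact h
      · have := hi (Nat.succ_le_of_lt h); simp only [Nat.succ_eq_add_one] at this; omega
  calc _ = ∑ h ∈ S, ‖v (i (h + 1)) - v (i h)‖ ^ 2 := by
        rw [hS, Finset.sum_filter]
        refine Finset.sum_congr rfl fun h _ => ?_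
        split_ifs with hlt
        · rfl
        · rw [le_antisymm (not_lt.1 hlt) (hi h.le_succ)]; simp
    _ ≤ ∑ h ∈ S, (2 * ‖v (i (h + 1))‖ ^ 2 + 2 * ‖v (i h)‖ ^ 2) := by
        refine Finset.sum_le_sum fun h _ => ?_
        have := norm_sub_le (v (i (h + 1))) (v (i h))
        nlinarith [sq_nonneg (‖v (i (h + 1))‖ - ‖v (i h)‖),
          norm_nonneg (v (i (h + 1)) - v (i h)), norm_nonneg (v (i h)),
          norm_nonneg (v (i (h + 1)))]
    _ ≤ _ := by
        rw [Finset.sum_add_distrib, ← Finset.mul_sum, ← Finset.mul_sum]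
        linarith

/-- The dyadic points of level `n` of `[a, b]`. -/
def dyadicPoint (a b : ℝ) (n k : ℕ) : ℝ := a + (b - a) * (k / 2 ^ n)

/-- The index of the last dyadic point of level `n` before `t`. -/
def dyadicIndex (a b : ℝ) (n : ℕ) (t : ℝ) : ℕ := ⌊(t - a) / (b - a) * 2 ^ n⌋₊

section Dyadic

variable {a b : ℝ}

theorem dyadicPoint_mem (hab : a < b) {n k : ℕ} (hk : k ≤ 2 ^ n) : dyadicPoint a b n k ∈ Icc a b := by
  have h1 : (k / 2 ^ n : ℝ) ≤ 1 := by
    rw [div_le_one (by positivity)]; exact_mod_cast hk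
  have h0 : (0 : ℝ) ≤ k / 2 ^ n := by positivity
  have hba : 0 ≤ b - a := sub_nonneg.2 hab.le
  constructor
  · exact le_add_of_nonneg_right (mul_nonneg hba h0)
  · have := mul_le_mul_of_nonneg_left h1 hba
    rw [dyadicPoint]; linarith

theorem dyadicPoint_succ_two_mul (n k : ℕ) :
    dyadicPoint a b (n + 1) (2 * k) = dyadicPoint a b n k := by
  rw [dyadicPoint, dyadicPoint, pow_succ']
  push_cast
  rw [mul_div_mul_left _ _ two_ne_zero]

theorem dyadicPoint_add_one_sub (n k : ℕ) :
    dyadicPoint a b n (k + 1) - dyadicPoint a b n k = (b - a) / 2 ^ n := by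
  simp only [dyadicPoint]; push_cast; ring

theorem dyadicIndex_mono (hab : a < b) (n : ℕ) : Monotone (dyadicIndex a b n) := by
  intro s t hst
  have : 0 < b - a := sub_pos.2 hab
  exact Nat.floor_mono (by gcongr)

theorem dyadicIndex_le (hab : a < b) (n : ℕ) {t : ℝ} (ht : t ∈ Icc a b) :
    dyadicIndex a b n t ≤ 2 ^ n := by
  have hba : 0 < b - a := sub_pos.2 hab
  refine Nat.floor_le_of_le ?_
  have : (t - a) / (b - a) ≤ 1 := by rw [div_le_one hba]; linarith [ht.2]
  calc _ ≤ 1 * (2 : ℝ) ^ n := by gcongr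
    _ = _ := by simp

theorem dyadicIndex_succ_div_two (n : ℕ) (t : ℝ) :
    dyadicIndex a b (n + 1) t / 2 = dyadicIndex a b n t := by
  rw [dyadicIndex, dyadicIndex, ← Nat.floor_div_ofNat]
  congr 1
  rw [pow_succ]
  ring

theorem abs_dyadicPoint_dyadicIndex_sub_le (hab : a < b) (n : ℕ) {t : ℝ} (ht : t ∈ Icc a b) :
    |dyadicPoint a b n (dyadicIndex a b n t) - t| ≤ (b - a) / 2 ^ n := by
  have hba : 0 < b - a := sub_pos.2 hab
  set x := (t - a) / (b - a) * 2 ^ n with hx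
  have hx0 : 0 ≤ x := mul_nonneg (div_nonneg (by linarith [ht.1]) hba.le) (by positivity)
  have h1 := Nat.floor_le hx0
  have h2 := Nat.lt_floor_add_one x
  have ht' : t = a + (b - a) * (x / 2 ^ n) := by
    rw [hx]; field_simp; ring
  have : dyadicPoint a b n (dyadicIndex a b n t) - t = (b - a) / 2 ^ n * ((⌊x⌋₊ : ℝ) - x) := by
    rw [dyadicPoint, dyadicIndex, ← hx]
    conv_lhs => rw [ht']
    ring
  rw [this, abs_mul, abs_of_pos (by positivity)]
  refine mul_le_of_le_one_right (by positivity) ?_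
  rw [abs_le]; constructor <;> linarith

theorem tendsto_dyadicPoint_dyadicIndex (hab : a < b) {t : ℝ} (ht : t ∈ Icc a b) :
    Tendsto (fun n => dyadicPoint a b n (dyadicIndex a b n t)) atTop (𝓝[Icc a b] t) := by
  rw [tendsto_nhdsWithin_iff]
  refine ⟨?_, Eventually.of_forall fun n => dyadicPoint_mem hab (dyadicIndex_le hab n ht)⟩
  rw [tendsto_iff_dist_tendsto_zero]
  have h : Tendsto (fun n : ℕ => (b - a) / 2 ^ n) atTop (𝓝 0) := by
    simpa [div_eq_mul_inv] using
      (tendsto_pow_atTop_nhds_zero_of_lt_one (r := (2 : ℝ)⁻¹) (by norm_num)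
        (by norm_num)).const_mul (b - a)
  exact squeeze_zero (fun _ => dist_nonneg)
    (fun n => abs_dyadicPoint_dyadicIndex_sub_le hab n ht) h

variable {E : Type*} [NormedAddCommGroup E]

/-- The jumps of the dyadic step function approximations of `φ`. -/
def dyadicJump (a b : ℝ) (φ : ℝ → E) : ℕ → ℕ → E
  | 0, k => φ (dyadicPoint a b 0 k) - φ a
  | n + 1, k => φ (dyadicPoint a b (n + 1) k) - φ (dyadicPoint a b n (k / 2))

/-- Telescoping: halving the index at level `n + 1` gives the index at level `n`. -/
theorem sum_dyadicJump (φ : ℝ → E) (N : ℕ) (t : ℝ) :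
    ∑ n ∈ Finset.range (N + 1), dyadicJump a b φ n (dyadicIndex a b n t) =
      φ (dyadicPoint a b N (dyadicIndex a b N t)) - φ a := by
  induction N with
  | zero => simp [dyadicJump]
  | succ N ih =>
    rw [Finset.sum_range_succ, ih, dyadicJump, dyadicIndex_succ_div_two]
    abel

/-- At positive levels an even index is a point of the previous level and has zero jump, while an
odd one gives a genuine dyadic increment. The left side has one more index because `t = b` has index
`2 ^ n`. -/
theorem sum_norm_dyadicJump_sq_le (φ : ℝ → E) (n : ℕ) :
    ∑ k ∈ Finset.range (2 ^ n + 1), ‖dyadicJump a b φ n k‖ ^ 2 ≤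
      ∑ k ∈ Finset.range (2 ^ n),
        ‖φ (dyadicPoint a b n (k + 1)) - φ (dyadicPoint a b n k)‖ ^ 2 := by
  rw [Finset.sum_range_succ']
  have ha : ∀ m, dyadicPoint a b m 0 = a := fun m => by simp [dyadicPoint]
  cases n with
  | zero => simp [dyadicJump, ha]
  | succ n =>
    have h0 : dyadicJump a b φ (n + 1) 0 = 0 := by simp [dyadicJump, ha]
    rw [h0, norm_zero, zero_pow two_ne_zero, add_zero]
    refine Finset.sum_le_sum fun k _ => ?_
    rw [dyadicJump]
    rcases Nat.even_or_odd' k with ⟨m, rfl | rfl⟩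
    · rw [show (2 * m + 1) / 2 = m by omega, ← dyadicPoint_succ_two_mul n m]
    · rw [show (2 * m + 1 + 1) / 2 = m + 1 by omega, ← dyadicPoint_succ_two_mul n (m + 1),
        show 2 * (m + 1) = 2 * m + 1 + 1 by ring, sub_self, norm_zero, zero_pow two_ne_zero]
      positivity

/-- The quadratic variation of a continuous function along any partition is controlled by a
weighted sum of its squared dyadic increments. -/
theorem sum_enorm_sub_sq_le_tsum_dyadic (hab : a < b) {φ : ℝ → E} (hφ : ContinuousOn φ (Icc a b))
    {ρ : ℝ≥0∞} (hρ0 : ρ ≠ 0) (hρ1 : ρ ≠ ∞) {T : ℕ → ℝ} (hT : Monotone T)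
    (hTab : ∀ h, T h ∈ Icc a b) (N : ℕ) :
    ∑ h ∈ Finset.range N, ‖φ (T (h + 1)) - φ (T h)‖ₑ ^ 2 ≤
      (∑' n : ℕ, ρ ^ (2 * n)) * ∑' n : ℕ, 4 * ρ⁻¹ ^ (2 * n) * ∑ k ∈ Finset.range (2 ^ n),
        ‖φ (dyadicPoint a b n (k + 1)) - φ (dyadicPoint a b n k)‖ₑ ^ 2 := by
  have hcv : ∀ s : Finset ℕ, ∀ f : ℕ → E, ∑ h ∈ s, ‖f h‖ₑ ^ 2 =
      ENNReal.ofReal (∑ h ∈ s, ‖f h‖ ^ 2) := fun s f => by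
    rw [ENNReal.ofReal_sum_of_nonneg fun _ _ => by positivity]
    refine Finset.sum_congr rfl fun h _ => ?_
    rw [ENNReal.ofReal_pow (norm_nonneg _), ofReal_norm]
  set D : ℕ → ℝ → E := fun n t => dyadicJump a b φ n (dyadicIndex a b n t) with hD
  have hsum : ∀ s ∈ Icc a b, ∀ t ∈ Icc a b, ‖φ t - φ s‖ₑ ≤ ∑' n, ‖D n t - D n s‖ₑ := by
    intro s hs t ht
    have hlim : Tendsto (fun n => ‖φ (dyadicPoint a b n (dyadicIndex a b n t)) -
        φ (dyadicPoint a b n (dyadicIndex a b n s))‖ₑ) atTop (𝓝 ‖φ t - φ s‖ₑ) :=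
      (((hφ t ht).tendsto.comp (tendsto_dyadicPoint_dyadicIndex hab ht)).sub
        ((hφ s hs).tendsto.comp (tendsto_dyadicPoint_dyadicIndex hab hs))).enorm
    refine le_of_tendsto' hlim fun n => ?_
    have : φ (dyadicPoint a b n (dyadicIndex a b n t)) -
        φ (dyadicPoint a b n (dyadicIndex a b n s)) =
        ∑ m ∈ Finset.range (n + 1), (D m t - D m s) := by
      rw [Finset.sum_sub_distrib, hD]
      simp only [sum_dyadicJump]
      abel
    rw [this]
    exact (enorm_sum_le (Finset.range (n + 1)) fun m => D m t - D m s).trans (ENNReal.sum_le_tsum _)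
  have hsq : ∀ h, ‖φ (T (h + 1)) - φ (T h)‖ₑ ^ 2 ≤ (∑' n : ℕ, ρ ^ (2 * n)) *
      ∑' n : ℕ, ρ⁻¹ ^ (2 * n) * ‖D n (T (h + 1)) - D n (T h)‖ₑ ^ 2 := by
    intro h
    calc _ ≤ (∑' n, ‖D n (T (h + 1)) - D n (T h)‖ₑ) ^ 2 :=
          pow_le_pow_left' (hsum _ (hTab h) _ (hTab (h + 1))) 2
      -- The weight is inserted so that Cauchy-Schwarz replaces the square of a sum over levels by a
      -- weighted sum of squares.
      _ = (∑' n, ρ ^ n * (ρ⁻¹ ^ n * ‖D n (T (h + 1)) - D n (T h)‖ₑ)) ^ 2 := by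
          congr 2
          ext n
          rw [← mul_assoc, ← mul_pow, ENNReal.mul_inv_cancel hρ0 hρ1, one_pow, one_mul]
      _ ≤ _ := tsum_mul_sq_le _ _
      _ = _ := by
          congr 1
          · congr 1; ext n; rw [← pow_mul, mul_comm]
          · congr 1; ext n; rw [mul_pow, ← pow_mul, mul_comm n 2]
  have hlevel : ∀ n, ∑ h ∈ Finset.range N, ‖D n (T (h + 1)) - D n (T h)‖ₑ ^ 2 ≤
      4 * ∑ k ∈ Finset.range (2 ^ n),
        ‖φ (dyadicPoint a b n (k + 1)) - φ (dyadicPoint a b n k)‖ₑ ^ 2 := by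
    intro n
    rw [hcv, hcv, ← ENNReal.ofReal_ofNat 4, ← ENNReal.ofReal_mul (by norm_num)]
    refine ENNReal.ofReal_le_ofReal ?_
    refine (sum_norm_sub_sq_le (dyadicJump a b φ n) (i := fun h => dyadicIndex a b n (T h))
      ((dyadicIndex_mono hab n).comp hT) (M := 2 ^ n + 1)
      fun h => Nat.lt_succ_of_le (dyadicIndex_le hab n (hTab h))).trans ?_
    gcongr
    exact sum_norm_dyadicJump_sq_le φ n
  calc _ ≤ ∑ h ∈ Finset.range N, (∑' n : ℕ, ρ ^ (2 * n)) *
      ∑' n : ℕ, ρ⁻¹ ^ (2 * n) * ‖D n (T (h + 1)) - D n (T h)‖ₑ ^ 2 :=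
        Finset.sum_le_sum fun h _ => hsq h
    _ = (∑' n : ℕ, ρ ^ (2 * n)) * ∑' n : ℕ, ρ⁻¹ ^ (2 * n) *
        ∑ h ∈ Finset.range N, ‖D n (T (h + 1)) - D n (T h)‖ₑ ^ 2 := by
        rw [← Finset.mul_sum, ← Summable.tsum_finsetSum fun _ _ => ENNReal.summable]
        simp only [Finset.mul_sum]
    _ ≤ _ := by
        refine mul_le_mul' le_rfl (ENNReal.tsum_le_tsum fun n => ?_)
        rw [mul_comm 4, mul_assoc]
        exact mul_le_mul' le_rfl (hlevel n)

end Dyadic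

/-! ### Measurability, Gaussian decay and integral estimates -/

/-- A process with almost surely continuous paths has a jointly measurable modification, for
which moreover almost every path agrees almost everywhere with that of the process. -/
theorem exists_measurable_uncurry_ae_eq {Ω E : Type*} [MeasurableSpace Ω] [NormedAddCommGroup E]
    [MeasurableSpace E] [BorelSpace E] {P : Measure Ω} [SFinite P] {a b : ℝ} (hab : a < b)
    {X : ℝ → Ω → E} (hX : ∀ t ∈ Icc a b, AEMeasurable (X t) P)
    (hcont : ∀ᵐ ω ∂P, ContinuousOn (fun t => X t ω) (Icc a b)) :
    ∃ Y : ℝ → Ω → E, Measurable (Function.uncurry Y) ∧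
      (∀ᵐ ω ∂P, ∀ᵐ t ∂volume.restrict (Icc a b), X t ω = Y t ω) ∧
      (∀ᵐ t ∂volume.restrict (Icc a b), ∀ᵐ ω ∂P, X t ω = Y t ω) := by
  -- Countably many measurable versions, one per dyadic time, give jointly measurable step functions
  -- that converge almost everywhere by continuity of paths. Indices beyond `2 ^ n` lie outside `[a,
  -- b]` and get a dummy value.
  have hZ : ∀ n k : ℕ, ∃ Z : Ω → E, Measurable Z ∧
      (k ≤ 2 ^ n → X (dyadicPoint a b n k) =ᵐ[P] Z) := fun n k => by
    by_cases hk : k ≤ 2 ^ n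
    · have := hX _ (dyadicPoint_mem hab hk)
      exact ⟨this.mk _, this.measurable_mk, fun _ => this.ae_eq_mk⟩
    · exact ⟨fun _ => 0, measurable_const, fun h => absurd h hk⟩
  choose Z hZm hZe using hZ
  have hidx : ∀ n, Measurable (dyadicIndex a b n) := fun n =>
    Nat.measurable_floor.comp (by fun_prop)
  have hf : ∀ n, Measurable fun p : ℝ × Ω => Z n (dyadicIndex a b n p.1) p.2 := fun n => by
    have h : Measurable fun p : ℕ × Ω => Z n p.1 p.2 :=
      measurable_from_prod_countable_right fun k => hZm n k
    exact h.comp (((hidx n).comp measurable_fst).prodMk measurable_snd)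
  have hae : ∀ᵐ ω ∂P, ContinuousOn (fun t => X t ω) (Icc a b) ∧
      ∀ n k, k ≤ 2 ^ n → X (dyadicPoint a b n k) ω = Z n k ω := by
    refine hcont.and (ae_all_iff.2 fun n => ae_all_iff.2 fun k => ?_)
    by_cases hk : k ≤ 2 ^ n
    · filter_upwards [hZe n k hk] with ω hω _ using hω
    · exact Eventually.of_forall fun _ h => absurd h hk
  have haem : AEMeasurable (Function.uncurry X) ((volume.restrict (Icc a b)).prod P) := by
    refine aemeasurable_of_tendsto_metrizable_ae atTop (fun n => (hf n).aemeasurable) ?_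
    filter_upwards [Measure.quasiMeasurePreserving_snd.ae hae,
      Measure.quasiMeasurePreserving_fst.ae (ae_restrict_mem measurableSet_Icc)] with p hp hp1
    refine ((hp.1 p.1 hp1).tendsto.comp (tendsto_dyadicPoint_dyadicIndex hab hp1)).congr
      fun n => ?_
    exact hp.2 n _ (dyadicIndex_le hab n hp1)
  refine ⟨fun t ω => haem.mk _ (t, ω), haem.measurable_mk, ?_, ?_⟩
  · exact Measure.ae_ae_of_ae_prod
      ((Measure.measurePreserving_swap (μ := P)).quasiMeasurePreserving.ae haem.ae_eq_mk)
  · exact Measure.ae_ae_of_ae_prod haem.ae_eq_mk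

/-- The characteristic function of a Gaussian vector with covariance at least `σ Id`. -/
theorem norm_charFun_map_le {Ω : Type*} [MeasurableSpace Ω] {P : Measure Ω} [IsProbabilityMeasure P]
    {d : ℕ} {Z : Ω → Rd d} (hZ : HasGaussianLaw Z P) {σ : ℝ}
    (hσ : (covMatrix Z P - σ • (1 : Matrix (Fin d) (Fin d) ℝ)).PosSemidef) (η : Rd d) :
    ‖charFun (P.map Z) η‖ ≤ Real.exp (-(σ * ‖η‖ ^ 2 / 2)) := by
  have hL2 : ∀ i, MemLp (fun ω => Z ω i) 2 P := fun i =>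
    hZ.memLp_two.eval_piLp i
  have hvar : Var[fun ω => inner ℝ η (Z ω); P] =
      ∑ i, ∑ j, η i * η j * covariance (fun ω => Z ω i) (fun ω => Z ω j) P := by
    have h := covarianceBilin_apply_pi hL2 η η
    change covarianceBilin (P.map Z) η η = _ at h
    rw [← h, covarianceBilin_self, variance_map (by fun_prop) hZ.aemeasurable]
    · rfl
    · exact (memLp_map_measure_iff aestronglyMeasurable_id hZ.aemeasurable).2 hZ.memLp_two
  have hle : σ * ‖η‖ ^ 2 ≤ Var[fun ω => inner ℝ η (Z ω); P] := by
    have h := hσ.dotProduct_mulVec_nonneg (η : Fin d → ℝ)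
    rw [Matrix.sub_mulVec, dotProduct_sub, sub_nonneg, Matrix.smul_mulVec, Matrix.one_mulVec,
      dotProduct_smul] at h
    rw [hvar, EuclideanSpace.real_norm_sq_eq]
    simp only [star_trivial, dotProduct, Matrix.mulVec, covMatrix, Matrix.of_apply,
      smul_eq_mul, Finset.mul_sum] at h ⊢
    refine le_trans (le_of_eq ?_) (h.trans (le_of_eq ?_))
    · simp only [sq]
    · refine Finset.sum_congr rfl fun i _ => Finset.sum_congr rfl fun j _ => ?_
      ring
  rw [hZ.charFun_map_eq, Complex.norm_exp, Real.exp_le_exp]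
  simp only [Complex.sub_re, Complex.mul_re, Complex.ofReal_re, Complex.I_re, mul_zero,
    Complex.ofReal_im, Complex.I_im, mul_one, sub_self, zero_sub]
  rw [← Complex.ofReal_ofNat, ← Complex.ofReal_div, Complex.ofReal_re]
  linarith

/-- The second moment of the integral of a bounded process. -/
theorem lintegral_enorm_integral_sq_le {Ω T : Type*} [MeasurableSpace Ω] [MeasurableSpace T]
    {P : Measure Ω} [IsFiniteMeasure P] {ν : Measure T} [IsFiniteMeasure ν] {f : T → Ω → ℂ}
    (hf : Measurable (Function.uncurry f)) (hf1 : ∀ t ω, ‖f t ω‖ ≤ 1) :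
    ∫⁻ ω, ‖∫ u, f u ω ∂ν‖ₑ ^ 2 ∂P ≤
      ∫⁻ u, ∫⁻ v, ‖∫ ω, f u ω * (starRingEnd ℂ) (f v ω) ∂P‖ₑ ∂ν ∂ν := by
  have hf' : Measurable fun p : T × Ω => f p.1 p.2 := hf
  set g : Ω → T × T → ℂ := fun ω z => f z.1 ω * (starRingEnd ℂ) (f z.2 ω) with hg
  have hgm : Measurable (Function.uncurry g) :=
    (hf'.comp (f := fun p : Ω × T × T => (p.2.1, p.1)) (by fun_prop)).mul
      (Complex.continuous_conj.measurable.comp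
        (hf'.comp (f := fun p : Ω × T × T => (p.2.2, p.1)) (by fun_prop)))
  have hg1 : ∀ ω z, ‖g ω z‖ ≤ 1 := fun ω z => by
    rw [hg, norm_mul, RCLike.norm_conj]
    exact mul_le_one₀ (hf1 _ _) (norm_nonneg _) (hf1 _ _)
  have hgint : Integrable (Function.uncurry g) (P.prod (ν.prod ν)) :=
    Integrable.of_bound hgm.aestronglyMeasurable 1 (Eventually.of_forall fun p => hg1 p.1 p.2)
  have hFm : StronglyMeasurable fun ω => ∫ u, f u ω ∂ν :=
    StronglyMeasurable.integral_prod_left' (f := fun p : T × Ω => f p.1 p.2) hf'.stronglyMeasurable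
  -- The square is unfolded as a double integral, so that the expectation can be taken inside before
  -- absolute values are.
  have hF : ∀ ω, ∫ z, g ω z ∂(ν.prod ν) = ((‖∫ u, f u ω ∂ν‖ ^ 2 : ℝ) : ℂ) := fun ω => by
    rw [hg, integral_prod_mul (fun u => f u ω) (fun v => (starRingEnd ℂ) (f v ω)), integral_conj,
      Complex.mul_conj, Complex.normSq_eq_norm_sq]
  have hFint : Integrable (fun ω => ‖∫ u, f u ω ∂ν‖ ^ 2) P := by
    have := hgint.integral_prod_left
    simp only [Function.uncurry] at this
    simp only [hF] at this
    exact_mod_cast this.re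
  calc _ = ∫⁻ ω, ENNReal.ofReal (‖∫ u, f u ω ∂ν‖ ^ 2) ∂P := by
        refine lintegral_congr fun ω => ?_
        rw [ENNReal.ofReal_pow (norm_nonneg _), ofReal_norm]
    _ = ENNReal.ofReal (∫ ω, ‖∫ u, f u ω ∂ν‖ ^ 2 ∂P) :=
        (ofReal_integral_eq_lintegral_ofReal hFint
          (Eventually.of_forall fun _ => by positivity)).symm
    _ = ‖∫ ω, ∫ z, g ω z ∂(ν.prod ν) ∂P‖ₑ := by
        simp only [hF]
        rw [integral_complex_ofReal, ← ofReal_norm, Complex.norm_real,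
          Real.norm_of_nonneg (integral_nonneg fun _ => by positivity)]
    _ = ‖∫ z, ∫ ω, g ω z ∂P ∂(ν.prod ν)‖ₑ := by rw [integral_integral_swap hgint]
    _ ≤ ∫⁻ z, ‖∫ ω, g ω z ∂P‖ₑ ∂(ν.prod ν) := enorm_integral_le_lintegral_enorm _
    _ = _ := by
        rw [lintegral_prod]
        exact (StronglyMeasurable.integral_prod_left'
          hgm.stronglyMeasurable).measurable.enorm.aemeasurable

/-- Scaling of the moments of a Gaussian function. -/
theorem exists_lintegral_norm_rpow_mul_exp {d : ℕ} (hd : 1 ≤ d) {α c : ℝ} (hα : 0 < α)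
    (hc : 0 < c) : ∃ K : ℝ, 0 ≤ K ∧ ∀ l : ℝ, 0 < l →
      ∫⁻ ξ : Rd d, ENNReal.ofReal (‖ξ‖ ^ (2 * α) * Real.exp (-(c * l ^ 2 * ‖ξ‖ ^ 2))) =
        ENNReal.ofReal (K * l ^ (-(2 * α + d))) := by
  -- This makes the space nontrivial, as integration in polar coordinates requires.
  have : Nonempty (Fin d) := ⟨⟨0, hd⟩⟩
  set f : Rd d → ℝ := fun ξ => ‖ξ‖ ^ (2 * α) * Real.exp (-c * ‖ξ‖ ^ 2) with hf
  have hf0 : ∀ ξ, 0 ≤ f ξ := fun ξ => by positivity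
  have hfint : Integrable f := by
    refine (integrable_fun_norm_addHaar volume
      (f := fun x : ℝ => x ^ (2 * α) * Real.exp (-c * x ^ 2))).2 ?_
    refine (integrableOn_rpow_mul_exp_neg_mul_sq hc (s := (d - 1 : ℕ) + 2 * α)
      (by have : (0 : ℝ) ≤ (d - 1 : ℕ) := by positivity
          linarith)).congr_fun (fun x hx => ?_) measurableSet_Ioi
    have hx0 : (0 : ℝ) < x := hx
    simp only [finrank_euclideanSpace_fin, smul_eq_mul]
    rw [Real.rpow_add hx0, Real.rpow_natCast, mul_assoc]
  refine ⟨∫ ξ, f ξ, integral_nonneg hf0, fun l hl => ?_⟩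
  have hint : Integrable fun ξ => f (l • ξ) := hfint.comp_smul hl.ne'
  have heq : ∀ ξ : Rd d, ‖ξ‖ ^ (2 * α) * Real.exp (-(c * l ^ 2 * ‖ξ‖ ^ 2)) =
      l ^ (-(2 * α)) * f (l • ξ) := fun ξ => by
    rw [hf]
    simp only [norm_smul, Real.norm_of_nonneg hl.le]
    rw [Real.mul_rpow hl.le (norm_nonneg _), ← mul_assoc, ← mul_assoc, ← Real.rpow_add hl,
      neg_add_cancel, Real.rpow_zero, one_mul]
    ring_nf
  simp only [heq]
  rw [← ofReal_integral_eq_lintegral_ofReal (hint.const_mul _)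
    (Eventually.of_forall fun ξ => mul_nonneg (by positivity) (hf0 _)), integral_const_mul,
    Measure.integral_comp_smul, finrank_euclideanSpace_fin, abs_of_pos (by positivity),
    smul_eq_mul, neg_add, Real.rpow_add hl, Real.rpow_neg hl.le (d : ℝ), Real.rpow_natCast]
  congr 1
  ring

/-- The double integral of `|u - v|^{-θ}` over a square. -/
theorem lintegral_abs_sub_rpow_le {θ s t : ℝ} (hθ0 : 0 < θ) (hθ : θ < 1) (hst : s ≤ t) :
    ∫⁻ u in Icc s t, ∫⁻ v in Icc s t, ENNReal.ofReal (|u - v| ^ (-θ)) ≤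
      ENNReal.ofReal (2 / (1 - θ) * (t - s) ^ (2 - θ)) := by
  have hL : 0 ≤ t - s := sub_nonneg.2 hst
  set g : ℝ → ℝ≥0∞ := (Ioc 0 (t - s)).indicator fun w => ENNReal.ofReal (w ^ (-θ)) with hg
  have hgm : Measurable g := Measurable.indicator (by fun_prop) measurableSet_Ioc
  have hgint : ∫⁻ w, g w = ENNReal.ofReal ((t - s) ^ (1 - θ) / (1 - θ)) := by
    have hexp : -1 < -θ := by linarith
    rw [hg, lintegral_indicator measurableSet_Ioc, ← ofReal_integral_eq_lintegral_ofReal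
      (intervalIntegral.intervalIntegrable_rpow' (a := 0) (b := t - s) hexp).1,
      ← intervalIntegral.integral_of_le hL, integral_rpow (Or.inl hexp),
      Real.zero_rpow (by linarith), sub_zero, neg_add_eq_sub]
    filter_upwards [ae_restrict_mem measurableSet_Ioc] with r hr
    have := hr.1
    positivity
  have hgeq : ∀ w, 0 < w → w ≤ t - s → g w = ENNReal.ofReal (w ^ (-θ)) := fun w h0 h1 =>
    indicator_of_mem (show w ∈ Ioc 0 (t - s) from ⟨h0, h1⟩) _
  have hin : ∀ u ∈ Icc s t, ∫⁻ v in Icc s t, ENNReal.ofReal (|u - v| ^ (-θ)) ≤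
      2 * ENNReal.ofReal ((t - s) ^ (1 - θ) / (1 - θ)) := by
    intro u hu
    calc _ ≤ ∫⁻ v in Icc s t, (g (u - v) + g (v - u)) := by
          refine setLIntegral_mono' measurableSet_Icc fun v hv => ?_
          rcases lt_trichotomy u v with h | h | h
          · refine le_add_left (le_of_eq ?_)
            rw [hgeq _ (by linarith) (by linarith [hu.1, hv.2]), abs_sub_comm,
              abs_of_pos (by linarith)]
          -- On the diagonal the real power `0 ^ (-θ)` is `0` by convention, since `θ ≠ 0`.
          · rw [h, sub_self, abs_zero, Real.zero_rpow (by linarith), ENNReal.ofReal_zero]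
            exact zero_le
          · refine le_add_right (le_of_eq ?_)
            rw [hgeq _ (by linarith) (by linarith [hv.1, hu.2]), abs_of_pos (by linarith)]
      _ ≤ ∫⁻ v, (g (u - v) + g (v - u)) := setLIntegral_le_lintegral _ _
      _ = _ := by
          rw [lintegral_add_left (by fun_prop), lintegral_sub_left_eq_self g u,
            lintegral_sub_right_eq_self g u, hgint, two_mul]
  calc _ ≤ ∫⁻ _ in Icc s t, 2 * ENNReal.ofReal ((t - s) ^ (1 - θ) / (1 - θ)) :=
        setLIntegral_mono' measurableSet_Icc hin
    _ = _ := by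
        rw [lintegral_const, Measure.restrict_apply_univ, Real.volume_Icc, ← ENNReal.ofReal_ofNat 2,
          ← ENNReal.ofReal_mul (by norm_num), ← ENNReal.ofReal_mul (mul_nonneg (by norm_num)
            (div_nonneg (by positivity) (by linarith)))]
        congr 1
        rw [show 2 - θ = (1 - θ) + 1 by ring, Real.rpow_add_one' hL (by linarith)]
        ring

/-! ### Energy of a deterministic continuous path -/

/-- The Fourier transform `∫_s^t e^{-2πi⟨w_u, ξ⟩} du` of the occupation measure of a path. -/
def pathFourier {d : ℕ} (w : ℝ → Rd d) (s t : ℝ) (ξ : Rd d) : ℂ :=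
  ∫ u in Icc s t, Complex.exp ((inner ℝ (w u) (-(2 * Real.pi) • ξ) : ℝ) * Complex.I)

/-- The squared homogeneous Sobolev norm of order `α` of the occupation measure of a path. -/
def pathEnergy {d : ℕ} (α : ℝ) (w : ℝ → Rd d) (s t : ℝ) : ℝ≥0∞ :=
  ∫⁻ ξ : Rd d, ENNReal.ofReal (‖ξ‖ ^ (2 * α)) * ‖pathFourier w s t ξ‖ₑ ^ 2

/-- The weighted sum of the energies of a path over all dyadic intervals of `[a, b]`. -/
def dyadicEnergy {d : ℕ} (ρ : ℝ≥0∞) (α a b : ℝ) (w : ℝ → Rd d) : ℝ≥0∞ :=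
  ∑' n : ℕ, 4 * ρ⁻¹ ^ (2 * n) * ∑ k ∈ Finset.range (2 ^ n),
    pathEnergy α w (dyadicPoint a b n k) (dyadicPoint a b n (k + 1))

section Path

variable {d : ℕ} {w : ℝ → Rd d} {a b : ℝ}

theorem aemeasurable_restrict_of_continuousOn (hw : ContinuousOn w (Icc a b)) {s t : ℝ}
    (hs : a ≤ s) (ht : t ≤ b) : AEMeasurable w (volume.restrict (Icc s t)) :=
  (hw.mono (Icc_subset_Icc hs ht)).aemeasurable measurableSet_Icc

theorem charFun_occupationMeasure (hw : ContinuousOn w (Icc a b)) {s t : ℝ} (hs : a ≤ s)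
    (ht : t ≤ b) (ξ : Rd d) :
    charFun (occupationMeasure w s t) (-(2 * Real.pi) • ξ) = pathFourier w s t ξ := by
  rw [charFun_apply, occupationMeasure, integral_map
    (aemeasurable_restrict_of_continuousOn hw hs ht)
    (Continuous.aestronglyMeasurable (by fun_prop))]
  rfl

theorem occupationMeasure_add (hw : ContinuousOn w (Icc a b)) {s t : ℝ} (hs : a ≤ s)
    (hst : s ≤ t) (ht : t ≤ b) :
    occupationMeasure w a t = occupationMeasure w a s + occupationMeasure w s t := by
  ext A hA
  simp only [occupationMeasure, Measure.add_apply]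
  rw [Measure.map_apply_of_aemeasurable (aemeasurable_restrict_of_continuousOn hw le_rfl ht) hA,
    Measure.map_apply_of_aemeasurable
      (aemeasurable_restrict_of_continuousOn hw le_rfl (hst.trans ht)) hA,
    Measure.map_apply_of_aemeasurable (aemeasurable_restrict_of_continuousOn hw hs ht) hA,
    ← Measure.restrict_congr_set (Ioc_ae_eq_Icc (a := s) (b := t)),
    ← Measure.add_apply, ← Measure.restrict_union _ measurableSet_Ioc,
    Icc_union_Ioc_eq_Icc hs hst]
  exact disjoint_left.2 fun x hx hx' => not_lt.2 hx.2 hx'.1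

/-- Increments are again positive finite measures, so the Sobolev bound applies to them; the shared
endpoint `s` is Lebesgue-null. -/
theorem toSignedMeasure_occupationMeasure_sub (hw : ContinuousOn w (Icc a b)) {s t : ℝ}
    (hs : a ≤ s) (hst : s ≤ t) (ht : t ≤ b) :
    (occupationMeasure w a t).toSignedMeasure - (occupationMeasure w a s).toSignedMeasure =
      (occupationMeasure w s t).toSignedMeasure := by
  rw [sub_eq_iff_eq_add, ← Measure.toSignedMeasure_add]
  congr 1
  rw [occupationMeasure_add hw hs hst ht, add_comm]

theorem occupationMeasure_self (w : ℝ → Rd d) (a : ℝ) :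
    occupationMeasure w a a = 0 := by
  rw [occupationMeasure, Icc_self, Measure.restrict_singleton]
  simp

theorem isCompactlySupported_occupationMeasure (hw : ContinuousOn w (Icc a b)) {t : ℝ}
    (ht : t ≤ b) : IsCompactlySupported (occupationMeasure w a t).toSignedMeasure := by
  refine ⟨w '' Icc a t, isCompact_Icc.image_of_continuousOn (hw.mono (Icc_subset_Icc le_rfl ht)),
    fun A hA hdisj => ?_⟩
  rw [Measure.toSignedMeasure_apply_measurable hA, measureReal_eq_zero_iff, occupationMeasure,
    Measure.map_apply_of_aemeasurable (aemeasurable_restrict_of_continuousOn hw le_rfl ht) hA]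
  have : w ⁻¹' A ⊆ (Icc a t)ᶜ := fun x hx hx' => hdisj.le_bot ⟨hx, mem_image_of_mem w hx'⟩
  refine measure_mono_null this ?_
  rw [Measure.restrict_apply measurableSet_Icc.compl, compl_inter_self, measure_empty]

theorem integrableOn_pathFourier (hw : ContinuousOn w (Icc a b)) (ξ : Rd d) :
    IntegrableOn (fun u => Complex.exp ((inner ℝ (w u) (-(2 * Real.pi) • ξ) : ℝ) * Complex.I))
      (Icc a b) :=
  ContinuousOn.integrableOn_compact isCompact_Icc
    ((by fun_prop : Continuous fun x : Rd d =>
      Complex.exp ((inner ℝ x (-(2 * Real.pi) • ξ) : ℝ) * Complex.I)).comp_continuousOn hw)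

theorem pathFourier_sub (hw : ContinuousOn w (Icc a b)) {s t : ℝ} (hs : a ≤ s)
    (hst : s ≤ t) (ht : t ≤ b) (ξ : Rd d) :
    pathFourier w a t ξ - pathFourier w a s ξ = pathFourier w s t ξ := by
  have hint := integrableOn_pathFourier hw ξ
  simp only [pathFourier]
  rw [sub_eq_iff_eq_add', integral_Icc_eq_integral_Ioc (x := s) (y := t),
    ← Icc_union_Ioc_eq_Icc hs hst, setIntegral_union _ measurableSet_Ioc
      (hint.mono_set (Icc_subset_Icc le_rfl (hst.trans ht)))
      (hint.mono_set (Ioc_subset_Icc_self.trans (Icc_subset_Icc hs ht)))]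
  exact disjoint_left.2 fun x hx hx' => not_lt.2 hx.2 hx'.1

theorem measurable_pathFourier (hw : ContinuousOn w (Icc a b)) {s t : ℝ} (hs : a ≤ s)
    (ht : t ≤ b) : Measurable (pathFourier w s t) := by
  simp only [← funext (charFun_occupationMeasure hw hs ht)]
  fun_prop

/-- Along any partition, the sum of the energies of the pieces of a path is controlled by its
dyadic energy. -/
theorem sum_pathEnergy_le (hab : a < b) (hw : ContinuousOn w (Icc a b)) (α : ℝ) {ρ : ℝ≥0∞}
    (hρ0 : ρ ≠ 0) (hρ1 : ρ ≠ ∞) {T : ℕ → ℝ} (hT : Monotone T) (hTab : ∀ h, T h ∈ Icc a b) (N : ℕ) :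
    ∑ h ∈ Finset.range N, pathEnergy α w (T h) (T (h + 1)) ≤
      (∑' n : ℕ, ρ ^ (2 * n)) * dyadicEnergy ρ α a b w := by
  have hmeas : ∀ s t, a ≤ s → t ≤ b → Measurable fun ξ : Rd d =>
      ENNReal.ofReal (‖ξ‖ ^ (2 * α)) * ‖pathFourier w s t ξ‖ₑ ^ 2 := fun s t hs ht => by
    have := measurable_pathFourier hw hs ht
    fun_prop
  have hpt : ∀ n, ∀ k ∈ Finset.range (2 ^ n), a ≤ dyadicPoint a b n k ∧
      dyadicPoint a b n k ≤ dyadicPoint a b n (k + 1) ∧ dyadicPoint a b n (k + 1) ≤ b := by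
    intro n k hk
    have hk' : k < 2 ^ n := Finset.mem_range.1 hk
    refine ⟨(dyadicPoint_mem hab hk'.le).1, ?_, (dyadicPoint_mem hab hk').2⟩
    rw [← sub_nonneg, dyadicPoint_add_one_sub]
    have := sub_pos.2 hab
    positivity
  have hcont : ∀ ξ, ContinuousOn (fun t => pathFourier w a t ξ) (Icc a b) := fun ξ =>
    intervalIntegral.continuousOn_primitive_Icc (integrableOn_pathFourier hw ξ)
  -- The dyadic inequality is applied one frequency at a time to `t ↦ pathFourier w a t ξ`.
  have hξ : ∀ ξ, ∑ h ∈ Finset.range N, ‖pathFourier w (T h) (T (h + 1)) ξ‖ₑ ^ 2 ≤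
      (∑' n : ℕ, ρ ^ (2 * n)) * ∑' n : ℕ, 4 * ρ⁻¹ ^ (2 * n) * ∑ k ∈ Finset.range (2 ^ n),
        ‖pathFourier w (dyadicPoint a b n k) (dyadicPoint a b n (k + 1)) ξ‖ₑ ^ 2 := by
    intro ξ
    convert sum_enorm_sub_sq_le_tsum_dyadic hab (hcont ξ) hρ0 hρ1 hT hTab N using 1
    · refine Finset.sum_congr rfl fun h _ => ?_
      rw [pathFourier_sub hw (hTab h).1 (hT h.le_succ) (hTab _).2]
    · congr 1
      refine tsum_congr fun n => ?_
      congr 1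
      refine Finset.sum_congr rfl fun k hk => ?_
      obtain ⟨h1, h2, h3⟩ := hpt n k hk
      rw [pathFourier_sub hw h1 h2 h3]
  have hmn : ∀ n, Measurable fun ξ : Rd d => 4 * ρ⁻¹ ^ (2 * n) * ∑ k ∈ Finset.range (2 ^ n),
      ENNReal.ofReal (‖ξ‖ ^ (2 * α)) *
        ‖pathFourier w (dyadicPoint a b n k) (dyadicPoint a b n (k + 1)) ξ‖ₑ ^ 2 := fun n =>
    (Finset.measurable_fun_sum _ fun k hk =>
      hmeas _ _ (hpt n k hk).1 (hpt n k hk).2.2).const_mul _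
  simp only [pathEnergy, dyadicEnergy]
  rw [← lintegral_finsetSum _ fun h _ => hmeas _ _ (hTab h).1 (hTab (h + 1)).2]
  calc _ ≤ ∫⁻ ξ : Rd d, (∑' n : ℕ, ρ ^ (2 * n)) * ∑' n : ℕ, 4 * ρ⁻¹ ^ (2 * n) *
        ∑ k ∈ Finset.range (2 ^ n), ENNReal.ofReal (‖ξ‖ ^ (2 * α)) *
          ‖pathFourier w (dyadicPoint a b n k) (dyadicPoint a b n (k + 1)) ξ‖ₑ ^ 2 := by
        refine lintegral_mono fun ξ => ?_
        simp only [← Finset.mul_sum]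
        calc _ ≤ ENNReal.ofReal (‖ξ‖ ^ (2 * α)) * _ := mul_le_mul' le_rfl (hξ ξ)
          _ = _ := by
            rw [mul_left_comm, ← ENNReal.tsum_mul_left]
            simp only [mul_left_comm]
    _ = _ := by
        rw [lintegral_const_mul _ (Measurable.tsum hmn),
          lintegral_tsum fun n => (hmn n).aemeasurable]
        congr 1
        refine tsum_congr fun n => ?_
        rw [lintegral_const_mul _ (Finset.measurable_fun_sum _ fun k hk =>
          hmeas _ _ (hpt n k hk).1 (hpt n k hk).2.2), lintegral_finsetSum _ fun k hk =>
          hmeas _ _ (hpt n k hk).1 (hpt n k hk).2.2]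

/-- The occupation measure of a continuous path of finite dyadic energy has finite quadratic
variation in `SBE^{α,2}_2`. -/
theorem memVSBE_occupationMeasure (hab : a < b) (hw : ContinuousOn w (Icc a b)) {α : ℝ}
    (hα0 : 0 < α) (hαeven : ∀ n : ℕ, α ≠ 2 * (n : ℝ)) {ρ : ℝ≥0∞} (hρ0 : ρ ≠ 0) (hρ1 : ρ < 1)
    (hfin : dyadicEnergy ρ α a b w ≠ ∞) :
    MemVSBE α 2 2 2 a b fun t => (occupationMeasure w a t).toSignedMeasure := by
  obtain ⟨C, hC, hCb⟩ := exists_sbeNorm_sq_le (d := d) hα0 hαeven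
  set f : ℝ → SignedMeasure (Rd d) := fun t => (occupationMeasure w a t).toSignedMeasure with hf
  set B := ENNReal.ofReal C * ((∑' n : ℕ, ρ ^ (2 * n)) * dyadicEnergy ρ α a b w) with hB
  have hBfin : B < ∞ := by
    refine ENNReal.mul_lt_top ENNReal.ofReal_lt_top (ENNReal.mul_lt_top ?_ hfin.lt_top)
    simp only [pow_mul]
    rw [ENNReal.tsum_geometric, ENNReal.inv_lt_top, tsub_pos_iff_lt]
    exact pow_lt_one₀ zero_le hρ1 two_ne_zero
  have hstep : ∀ s t, a ≤ s → s ≤ t → t ≤ b →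
      sbeNorm α 2 2 (f t - f s) ^ 2 ≤ ENNReal.ofReal C * pathEnergy α w s t := by
    intro s t hs hst ht
    rw [hf]
    simp only [toSignedMeasure_occupationMeasure_sub hw hs hst ht]
    refine (hCb (occupationMeasure w s t)).trans_eq ?_
    simp only [charFun_occupationMeasure hw hs ht]
    rfl
  have hvar : ∀ (T : ℕ → ℝ), Monotone T → (∀ h, T h ∈ Icc a b) → ∀ N,
      ∑ h ∈ Finset.range N, sbeNorm α 2 2 (f (T (h + 1)) - f (T h)) ^ 2 ≤ B := by
    intro T hT hTab N
    calc _ ≤ ∑ h ∈ Finset.range N, ENNReal.ofReal C * pathEnergy α w (T h) (T (h + 1)) :=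
          Finset.sum_le_sum fun h _ => hstep _ _ (hTab h).1 (hT h.le_succ) (hTab _).2
      _ ≤ B := by
          rw [← Finset.mul_sum]
          exact mul_le_mul' le_rfl
            (sum_pathEnergy_le hab hw α hρ0 (hρ1.trans ENNReal.one_lt_top).ne hT hTab N)
  refine ⟨fun t ht => ⟨isCompactlySupported_occupationMeasure hw ht.2, ?_⟩, ?_⟩
  -- Membership at time `t` is the bound for the single step from `a` to `t`, as `f a = 0`.
  · have h := hvar (fun h => if h = 0 then a else t)
      (monotone_nat_of_le_succ fun h => by by_cases h0 : h = 0 <;> simp [h0, ht.1])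
      (fun h => by by_cases h0 : h = 0 <;> simp [h0, ht.1, ht.2, hab.le]) 1
    have hfa : f a = 0 := by
      rw [hf]
      simp only [occupationMeasure_self]
      exact Measure.toSignedMeasure_zero
    simp only [Finset.sum_range_one, zero_add, one_ne_zero, if_false, if_true, hfa, sub_zero] at h
    exact (ENNReal.pow_lt_top_iff.1 (h.trans_lt hBfin)).resolve_right two_ne_zero
  · refine lt_of_le_of_lt (iSup_le fun n => iSup_le fun t => iSup_le fun ht => ?_) hBfin
    obtain ⟨hmono, h0, h1⟩ := ht
    -- The partition is continued by the constant `b`, so that it becomes a monotone sequence on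
    -- `ℕ`.
    set T : ℕ → ℝ := fun h => t ⟨min h n, by omega⟩ with hT
    have h := hvar T (fun i j hij => hmono.monotone (by
      rw [Fin.mk_le_mk]; exact min_le_min_right n hij)) (fun h => ⟨by
        rw [← h0]; exact hmono.monotone (Fin.zero_le _), by
        rw [← h1]; exact hmono.monotone (Fin.le_last _)⟩) n
    refine le_trans (le_of_eq ?_) h
    rw [Finset.sum_range]
    refine Finset.sum_congr rfl fun i _ => ?_
    rw [ENNReal.rpow_two]
    have e1 : T (i + 1) = t i.succ := 
      congrArg t (Fin.ext (by simp))
    have e2 : T i = t i.castSucc := 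
      congrArg t (Fin.ext (by simp))
    rw [e1, e2]

end Path

/-! ### Expected energy of the random path -/

section Energy

variable {Ω : Type*} [MeasurableSpace Ω] {d : ℕ}

theorem pathFourier_congr {w w' : ℝ → Rd d} {a b s t : ℝ} (hs : a ≤ s) (ht : t ≤ b)
    (h : ∀ᵐ u ∂volume.restrict (Icc a b), w u = w' u) (ξ : Rd d) :
    pathFourier w s t ξ = pathFourier w' s t ξ := by
  refine integral_congr_ae ?_
  filter_upwards [ae_restrict_of_ae_restrict_of_subset (Icc_subset_Icc hs ht) h] with u hu
  rw [hu]

/-- This transfers finiteness of the energy from the jointly measurable modification back to the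
process, whose paths are the continuous ones. -/
theorem dyadicEnergy_congr {w w' : ℝ → Rd d} {a b : ℝ} (hab : a < b) (ρ : ℝ≥0∞) (α : ℝ)
    (h : ∀ᵐ u ∂volume.restrict (Icc a b), w u = w' u) :
    dyadicEnergy ρ α a b w = dyadicEnergy ρ α a b w' := by
  refine tsum_congr fun n => ?_
  congr 1
  refine Finset.sum_congr rfl fun k hk => ?_
  have hk' : k < 2 ^ n := Finset.mem_range.1 hk
  refine lintegral_congr fun ξ => ?_
  rw [pathFourier_congr (dyadicPoint_mem hab hk'.le).1 (dyadicPoint_mem hab hk').2 h]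

theorem measurable_uncurry_pathFourier {Y : ℝ → Ω → Rd d} (hY : Measurable (Function.uncurry Y))
    (s t : ℝ) : Measurable fun p : Ω × Rd d => pathFourier (fun u => Y u p.1) s t p.2 := by
  have hY' : Measurable fun q : ℝ × Ω × Rd d => Y q.1 q.2.1 :=
    hY.comp (f := fun q : ℝ × Ω × Rd d => (q.1, q.2.1)) (by fun_prop)
  have h : Measurable fun q : ℝ × Ω × Rd d =>
      Complex.exp ((inner ℝ (Y q.1 q.2.1) (-(2 * Real.pi) • q.2.2) : ℝ) * Complex.I) := by
    fun_prop
  exact (StronglyMeasurable.integral_prod_left' h.stronglyMeasurable).measurable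

theorem measurable_pathEnergy {Y : ℝ → Ω → Rd d} (hY : Measurable (Function.uncurry Y))
    (α s t : ℝ) : Measurable fun ω => pathEnergy α (fun u => Y u ω) s t := by
  have h := measurable_uncurry_pathFourier hY s t
  refine Measurable.lintegral_prod_right' (f := fun p : Ω × Rd d =>
    ENNReal.ofReal (‖p.2‖ ^ (2 * α)) * ‖pathFourier (fun u => Y u p.1) s t p.2‖ₑ ^ 2) ?_
  fun_prop

/-- The second moment of the Fourier transform of the occupation measure of a process whose
increments have Gaussian decay of their characteristic functions. -/
theorem lintegral_enorm_pathFourier_sq_le {P : Measure Ω} [IsProbabilityMeasure P]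
    {Y : ℝ → Ω → Rd d} (hY : Measurable (Function.uncurry Y)) {a b s t : ℝ} {g : ℝ → ℝ → ℝ}
    {ξ : Rd d} (hs : a ≤ s) (ht : t ≤ b)
    (hg : ∀ᵐ u ∂volume.restrict (Icc a b), ∀ᵐ v ∂volume.restrict (Icc a b),
      ‖charFun (P.map fun ω => Y u ω - Y v ω) (-(2 * Real.pi) • ξ)‖ ≤ g u v) :
    ∫⁻ ω, ‖pathFourier (fun u => Y u ω) s t ξ‖ₑ ^ 2 ∂P ≤
      ∫⁻ u in Icc s t, ∫⁻ v in Icc s t, ENNReal.ofReal (g u v) := by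
  have hY' : Measurable fun q : ℝ × Ω => Y q.1 q.2 := hY
  have hYt : ∀ u, Measurable (Y u) := fun u => hY'.comp measurable_prodMk_left
  refine (lintegral_enorm_integral_sq_le (P := P) (ν := volume.restrict (Icc s t))
    (f := fun u ω => Complex.exp ((inner ℝ (Y u ω) (-(2 * Real.pi) • ξ) : ℝ) * Complex.I))
    (by unfold Function.uncurry; fun_prop) fun u ω => norm_exp_mul_I_le _).trans ?_
  refine lintegral_mono_ae ?_
  filter_upwards [ae_restrict_of_ae_restrict_of_subset (Icc_subset_Icc hs ht) hg] with u hu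
  refine lintegral_mono_ae ?_
  filter_upwards [ae_restrict_of_ae_restrict_of_subset (Icc_subset_Icc hs ht) hu] with v hv
  rw [← ofReal_norm]
  refine ENNReal.ofReal_le_ofReal (le_trans (le_of_eq ?_) hv)
  have hm : AEMeasurable (fun ω => Y u ω - Y v ω) P := ((hYt u).sub (hYt v)).aemeasurable
  rw [charFun_apply, integral_map hm
    (Continuous.aestronglyMeasurable (by fun_prop))]
  congr 2
  ext ω
  rw [← Complex.exp_conj, ← Complex.exp_add]
  congr 1
  simp only [inner_sub_left, map_mul, Complex.conj_ofReal, Complex.conj_I]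
  push_cast
  ring

/-- The expected energy of a process whose increments have Gaussian decay of their characteristic
functions. -/
theorem exists_lintegral_pathEnergy_le (hd : 1 ≤ d) {P : Measure Ω} [IsProbabilityMeasure P]
    {Y : ℝ → Ω → Rd d} (hY : Measurable (Function.uncurry Y)) {a b c H α : ℝ} (hc : 0 < c)
    (hH : 0 < H) (hα : 0 < α) (hθ : H * (2 * α + d) < 1)
    (hchar : ∀ᵐ u ∂volume.restrict (Icc a b), ∀ᵐ v ∂volume.restrict (Icc a b), ∀ ξ : Rd d,
      ‖charFun (P.map fun ω => Y u ω - Y v ω) (-(2 * Real.pi) • ξ)‖ ≤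
        Real.exp (-(c * |u - v| ^ (2 * H) * ‖ξ‖ ^ 2))) :
    ∃ K : ℝ, 0 ≤ K ∧ ∀ s t, a ≤ s → s ≤ t → t ≤ b →
      ∫⁻ ω, pathEnergy α (fun u => Y u ω) s t ∂P ≤
        ENNReal.ofReal (K * (t - s) ^ (2 - H * (2 * α + d))) := by
  obtain ⟨A, hA, hAb⟩ := exists_lintegral_norm_rpow_mul_exp hd hα hc
  set θ := H * (2 * α + d) with hθdef
  have hθ0 : 0 < θ := by positivity
  refine ⟨A * (2 / (1 - θ)), mul_nonneg hA (div_nonneg (by norm_num) (by linarith)),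
    fun s t hs hst ht => ?_⟩
  set ν := volume.restrict (Icc s t) with hν
  have hmF := measurable_uncurry_pathFourier hY s t
  have hmE : Measurable fun q : Rd d × ℝ × ℝ => ENNReal.ofReal
      (‖q.1‖ ^ (2 * α) * Real.exp (-(c * |q.2.1 - q.2.2| ^ (2 * H) * ‖q.1‖ ^ 2))) := by
    fun_prop
  -- The Gaussian moment formula with `l = |u - v| ^ H`.
  have hscale : ∀ u v : ℝ, u ≠ v → ∫⁻ ξ : Rd d, ENNReal.ofReal
      (‖ξ‖ ^ (2 * α) * Real.exp (-(c * |u - v| ^ (2 * H) * ‖ξ‖ ^ 2))) =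
        ENNReal.ofReal A * ENNReal.ofReal (|u - v| ^ (-θ)) := by
    intro u v huv
    have h0 : 0 < |u - v| := abs_pos.2 (sub_ne_zero.2 huv)
    have h1 : |u - v| ^ (-θ) = (|u - v| ^ H) ^ (-(2 * α + d)) := by
      rw [hθdef, ← mul_neg, Real.rpow_mul h0.le]
    have h2 : |u - v| ^ (2 * H) = (|u - v| ^ H) ^ 2 := by
      rw [mul_comm 2 H, Real.rpow_mul h0.le, Real.rpow_two]
    rw [← ENNReal.ofReal_mul hA, h1, h2, hAb _ (Real.rpow_pos_of_pos h0 H)]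
  calc _ = ∫⁻ ξ : Rd d, ∫⁻ ω, ENNReal.ofReal (‖ξ‖ ^ (2 * α)) *
        ‖pathFourier (fun u => Y u ω) s t ξ‖ₑ ^ 2 ∂P :=
        lintegral_lintegral_swap (f := fun ω ξ => ENNReal.ofReal (‖ξ‖ ^ (2 * α)) *
          ‖pathFourier (fun u => Y u ω) s t ξ‖ₑ ^ 2)
          (Measurable.aemeasurable (by unfold Function.uncurry; fun_prop))
    _ ≤ ∫⁻ ξ : Rd d, ∫⁻ z, ENNReal.ofReal (‖ξ‖ ^ (2 * α) *
          Real.exp (-(c * |z.1 - z.2| ^ (2 * H) * ‖ξ‖ ^ 2))) ∂(ν.prod ν) := by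
        refine lintegral_mono fun ξ => ?_
        rw [lintegral_const_mul' _ _ ENNReal.ofReal_ne_top]
        simp only [ENNReal.ofReal_mul (Real.rpow_nonneg (norm_nonneg ξ) (2 * α))]
        rw [lintegral_const_mul' _ _ ENNReal.ofReal_ne_top,
          lintegral_prod _ (Measurable.aemeasurable (by fun_prop))]
        exact mul_le_mul' le_rfl (lintegral_enorm_pathFourier_sq_le hY hs ht
          (hchar.mono fun u hu => hu.mono fun v hv => hv ξ))
    _ = ∫⁻ z, ∫⁻ ξ : Rd d, ENNReal.ofReal (‖ξ‖ ^ (2 * α) *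
          Real.exp (-(c * |z.1 - z.2| ^ (2 * H) * ‖ξ‖ ^ 2))) ∂volume ∂(ν.prod ν) :=
        lintegral_lintegral_swap hmE.aemeasurable
    _ = ∫⁻ u, ∫⁻ v, ∫⁻ ξ : Rd d, ENNReal.ofReal (‖ξ‖ ^ (2 * α) *
          Real.exp (-(c * |u - v| ^ (2 * H) * ‖ξ‖ ^ 2))) ∂volume ∂ν ∂ν :=
        lintegral_prod _ (Measurable.lintegral_prod_right'
          (hmE.comp measurable_swap)).aemeasurable
    _ = ∫⁻ u, ∫⁻ v, ENNReal.ofReal A * ENNReal.ofReal (|u - v| ^ (-θ)) ∂ν ∂ν := by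
        refine lintegral_congr fun u => lintegral_congr_ae ?_
        -- The diagonal must be discarded: there the integral over `ξ` is infinite, while `0 ^ (-θ)`
        -- is `0`.
        have : ∀ᵐ v ∂ν, v ≠ u := ae_restrict_of_ae (Measure.ae_ne volume u)
        filter_upwards [this] with v hv
        exact hscale u v hv.symm
    _ ≤ _ := by
        simp only [lintegral_const_mul' _ _ ENNReal.ofReal_ne_top]
        rw [mul_assoc, ENNReal.ofReal_mul hA]
        exact mul_le_mul' le_rfl (lintegral_abs_sub_rpow_le hθ0 hθ hst)

/-- A power bound on the expected energies over intervals, with exponent larger than `1`, makes the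
dyadic energy almost surely finite for a suitable weight. -/
theorem exists_ae_dyadicEnergy_ne_top {P : Measure Ω} {Y : ℝ → Ω → Rd d}
    (hY : Measurable (Function.uncurry Y)) {a b K θ α : ℝ} (hab : a < b) (hK : 0 ≤ K) (hθ : θ < 1)
    (hE : ∀ s t, a ≤ s → s ≤ t → t ≤ b → ∫⁻ ω, pathEnergy α (fun u => Y u ω) s t ∂P ≤
        ENNReal.ofReal (K * (t - s) ^ (2 - θ))) :
    ∃ ρ : ℝ≥0∞, ρ ≠ 0 ∧ ρ < 1 ∧ ∀ᵐ ω ∂P, dyadicEnergy ρ α a b (fun u => Y u ω) ≠ ∞ := by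
  -- Chosen so that the unweighted expectation at level `n` is of order `2^{-n(1 - θ)} = r ^ (4n)`;
  -- the weight `r ^ (-2n)` then still leaves the summable `r ^ (2n)`.
  set r : ℝ := 2 ^ (-(1 - θ) / 4) with hr
  have hr0 : 0 < r := by positivity
  have hr1 : r < 1 := Real.rpow_lt_one_of_one_lt_of_neg (by norm_num) (by linarith)
  have hba : 0 < b - a := sub_pos.2 hab
  have hr4 : 2 * ((2 : ℝ)⁻¹) ^ (2 - θ) = r ^ 4 := by
    rw [hr, ← Real.rpow_natCast, ← Real.rpow_mul (by norm_num), Real.inv_rpow (by norm_num),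
      ← Real.rpow_neg (by norm_num), ← Real.rpow_one_add' (by norm_num) (by linarith)]
    congr 1
    push_cast; ring
  have hmE := fun s t => measurable_pathEnergy hY α s t
  refine ⟨ENNReal.ofReal r, by simpa using hr0, by simpa using hr1, ?_⟩
  have hmeas : Measurable fun ω => dyadicEnergy (ENNReal.ofReal r) α a b (fun u => Y u ω) := by
    unfold dyadicEnergy
    fun_prop
  refine (ae_lt_top hmeas ?_).mono fun ω hω => hω.ne
  have hterm : ∀ n : ℕ, ∫⁻ ω, 4 * (ENNReal.ofReal r)⁻¹ ^ (2 * n) * ∑ k ∈ Finset.range (2 ^ n),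
      pathEnergy α (fun u => Y u ω) (dyadicPoint a b n k) (dyadicPoint a b n (k + 1)) ∂P ≤
        ENNReal.ofReal (4 * (K * (b - a) ^ (2 - θ))) * ENNReal.ofReal (r ^ 2) ^ n := by
    intro n
    rw [lintegral_const_mul _ (by fun_prop), lintegral_finsetSum _ fun k _ => hmE _ _]
    calc _ ≤ 4 * (ENNReal.ofReal r)⁻¹ ^ (2 * n) * ∑ _k ∈ Finset.range (2 ^ n),
          ENNReal.ofReal (K * ((b - a) / 2 ^ n) ^ (2 - θ)) := by
          refine mul_le_mul' le_rfl (Finset.sum_le_sum fun k hk => ?_)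
          have hk' : k < 2 ^ n := Finset.mem_range.1 hk
          rw [← dyadicPoint_add_one_sub n k]
          refine hE _ _ (dyadicPoint_mem hab hk'.le).1 ?_ (dyadicPoint_mem hab hk').2
          rw [← sub_nonneg, dyadicPoint_add_one_sub]
          positivity
      _ = ENNReal.ofReal (4 * (r⁻¹) ^ (2 * n) *
          (2 ^ n * (K * ((b - a) / 2 ^ n) ^ (2 - θ)))) := by
          rw [Finset.sum_const, Finset.card_range, nsmul_eq_mul,
            ENNReal.ofReal_mul (p := 4 * r⁻¹ ^ (2 * n)) (by positivity),
            ENNReal.ofReal_mul (p := 4) (by norm_num),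
            ENNReal.ofReal_pow (p := r⁻¹) (by positivity), ENNReal.ofReal_inv_of_pos hr0,
            ENNReal.ofReal_mul (p := 2 ^ n) (by positivity), ENNReal.ofReal_pow (p := 2) (by norm_num)]
          simp
      _ = _ := by
          rw [← ENNReal.ofReal_pow (by positivity), ← ENNReal.ofReal_mul (by positivity)]
          congr 1
          have h1 : ((b - a) / 2 ^ n) ^ (2 - θ) = (b - a) ^ (2 - θ) * ((2 : ℝ)⁻¹ ^ (2 - θ)) ^ n := by
            rw [div_eq_mul_inv, Real.mul_rpow hba.le (by positivity), ← inv_pow,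
              ← Real.rpow_natCast_mul (by norm_num), mul_comm (n : ℝ),
              Real.rpow_mul_natCast (by norm_num)]
          have h2 : (2 : ℝ) ^ n * ((2 : ℝ)⁻¹ ^ (2 - θ)) ^ n = r ^ (4 * n) := by
            rw [← mul_pow, hr4, ← pow_mul]
          calc _ = 4 * (K * (b - a) ^ (2 - θ)) * ((r⁻¹) ^ (2 * n) *
                (2 ^ n * ((2 : ℝ)⁻¹ ^ (2 - θ)) ^ n)) := by rw [h1]; ring
            _ = _ := by
                rw [h2, ← pow_mul, show 4 * n = 2 * n + 2 * n by ring, pow_add, ← mul_assoc (r⁻¹ ^ _),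
                  ← mul_pow, inv_mul_cancel₀ hr0.ne', one_pow, one_mul]
  unfold dyadicEnergy
  rw [lintegral_tsum fun n => Measurable.aemeasurable (by fun_prop)]
  refine ne_top_of_le_ne_top ?_ (ENNReal.tsum_le_tsum hterm)
  rw [ENNReal.tsum_mul_left, ENNReal.tsum_geometric]
  refine ENNReal.mul_ne_top ENNReal.ofReal_ne_top (ENNReal.inv_ne_top.2 ?_)
  exact (tsub_pos_of_lt (ENNReal.ofReal_lt_one.2 (pow_lt_one₀ hr0.le hr1 two_ne_zero))).ne'

end Energy

end Variation

end SmallBall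

end

/-! ### Conclusion for the Gaussian process -/

theorem corollary4p4
    {Ω : Type*} [MeasurableSpace Ω] (P : Measure Ω) [IsProbabilityMeasure P]
    (d : ℕ) (hd : 1 ≤ d) (a b : ℝ) (hab : a < b)
    (H : ℝ) (hH0 : 0 < H) (hH1 : H < 1)
    (X : ℝ → Ω → SmallBall.Rd d)
    (hgauss : IsGaussianProcess (fun t : Set.Icc a b => X (t : ℝ)) P)
    (hcont : ∀ᵐ ω ∂P, ContinuousOn (fun t => X t ω) (Set.Icc a b))
    (hcov : ∃ c : ℝ, 0 < c ∧ ∀ s ∈ Set.Icc a b, ∀ t ∈ Set.Icc a b,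
      (SmallBall.covMatrix (fun ω => X t ω - X s ω) P
        - (c * |t - s| ^ (2 * H)) • (1 : Matrix (Fin d) (Fin d) ℝ)).PosSemidef)
    (α : ℝ) (hα0 : 0 < α) (hα : α < 1 / (2 * H) - (d : ℝ) / 2)
    (hαeven : ∀ n : ℕ, α ≠ 2 * (n : ℝ)) :
    ∀ᵐ ω ∂P, SmallBall.MemVSBE α 2 2 2 a b
      (fun t => (SmallBall.occupationMeasure (fun r => X r ω) a t).toSignedMeasure) := by
  obtain ⟨c, hc, hcov⟩ := hcov
  have hθ : H * (2 * α + d) < 1 := by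
    have h1 : 2 * α + d < 1 / H := by
      have : 1 / (2 * H) = 1 / H / 2 := by rw [mul_comm, div_div]
      linarith
    rwa [lt_div_iff₀ hH0, mul_comm] at h1
  obtain ⟨Y, hY, hY1, hY2⟩ := SmallBall.exists_measurable_uncurry_ae_eq hab
    (fun t ht => hgauss.aemeasurable (⟨t, ht⟩ : Set.Icc a b)) hcont
  -- Only almost every time is available, since `Y u` and `X u` are known to agree almost surely
  -- only for almost every `u`. The constant is `c * (2π)² / 2`, from the frequency `-2πξ`.
  have hchar : ∀ᵐ u ∂volume.restrict (Icc a b), ∀ᵐ v ∂volume.restrict (Icc a b),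
      ∀ ξ : SmallBall.Rd d,
      ‖charFun (P.map fun ω => Y u ω - Y v ω) (-(2 * Real.pi) • ξ)‖ ≤
        Real.exp (-(2 * Real.pi ^ 2 * c * |u - v| ^ (2 * H) * ‖ξ‖ ^ 2)) := by
    filter_upwards [hY2, ae_restrict_mem measurableSet_Icc] with u hu hu'
    filter_upwards [hY2, ae_restrict_mem measurableSet_Icc] with v hv hv' ξ
    have hmap : P.map (fun ω => Y u ω - Y v ω) = P.map (fun ω => X u ω - X v ω) := by
      refine Measure.map_congr ?_
      filter_upwards [hu, hv] with ω h1 h2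
      rw [h1, h2]
    have hG : HasGaussianLaw (fun ω => X u ω - X v ω) P :=
      hgauss.hasGaussianLaw_fun_sub (s := ⟨u, hu'⟩) (t := ⟨v, hv'⟩)
    rw [hmap]
    refine (SmallBall.norm_charFun_map_le hG (hcov v hv' u hu') _).trans_eq ?_
    rw [norm_smul, norm_neg, Real.norm_of_nonneg (by positivity)]
    congr 1
    ring
  obtain ⟨K, hK, hKb⟩ := SmallBall.exists_lintegral_pathEnergy_le hd hY
    (by positivity : 0 < 2 * Real.pi ^ 2 * c) hH0 hα0 hθ hchar
  obtain ⟨ρ, hρ0, hρ1, hρ⟩ := SmallBall.exists_ae_dyadicEnergy_ne_top hY hab hK hθ hKb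
  filter_upwards [hcont, hY1, hρ] with ω h1 h2 h3
  refine SmallBall.memVSBE_occupationMeasure hab h1 hα0 hαeven hρ0 hρ1 ?_
  rwa [SmallBall.dyadicEnergy_congr hab ρ α h2]
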